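/- **Set-up.** Let $Q$ be the quiver with nodes $e_0,e_1,e_2$ and arrows $z^i:e_0\to e_1$, $z^i:e_1\to e_2$, $w_i:e_1\to e_0$, $w_i:e_2\to e_1$ ($i=1,2,3$). Words are read from right to left, and $(\cdots)_{ab}$ denotes a path from $e_b$ to $e_a$. For a commutative $\mathbb C$-algebra $K$, a unit $q\in K^\times$ and $s,t\in K$, consider the following reduction rules (each left-hand side is called a tip). Essential rules: 1. $(z^1z^2)_{20}\mapsto q^{-1}z^2z^1$, $(z^2z^3)_{20}\mapsto q^{-1}z^3z^2$, $(z^1z^3)_{20}\mapsto qz^3z^1$ 2. $(w_1w_2)_{02}\mapsto q^{-1}w_2w_1$, $(w_2w_3)_{02}\mapsto q^{-1}w_3w_2$, $(w_1w_3)_{02}\mapsto qw_3w_1$ 3. $(z^1w_2)_{11}\mapsto qw_2z^1$, $(z^1w_3)_{11}\mapsto q^{-1}w_3z^1$, $(z^2w_3)_{11}\mapsto qw_3z^2$ 4. $(z^2w_1)_{11}\mapsto q^{-1}w_1z^2$, $(z^3w_1)_{11}\mapsto qw_1z^3$, $(z^3w_2)_{11}\mapsto q^{-1}w_2z^3$ 5.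 $(z^1w_1)_{11}\mapsto w_1z^1-s$, $(z^2w_2)_{11}\mapsto w_2z^2-s$ 6. $(z^3w_3)_{11}\mapsto -w_1z^1-w_2z^2+t+\frac s2$ 7. $(w_3z^3)_{11}\mapsto -w_1z^1-w_2z^2+t+\frac{3s}2$ 8. $(w_3z^3)_{00}\mapsto -w_1z^1-w_2z^2+t+\frac s2$ 9. $(z^3w_3)_{22}\mapsto -z^1w_1-z^2w_2+t-\frac s2$ Superfluous rules: 10. $(z^1w_1z^2)_{21}\mapsto z^2w_1z^1-sz^2$, $(z^1w_2z^2)_{21}\mapsto z^2w_2z^1+sz^1$ 11. $(z^1w_3z^2)_{21}\mapsto q^{-3}z^2w_3z^1$, $(z^1w_1z^3)_{21}\mapsto z^3w_1z^1-sz^3$ 12. $(z^1w_2z^3)_{21}\mapsto q^3z^3w_2z^1$, $(z^2w_1z^3)_{21}\mapsto q^{-3}z^3w_1z^2$ 13. $(z^2w_2z^3)_{21}\mapsto z^3w_2z^2-sz^3$, $(w_1z^1w_2)_{12}\mapsto w_2z^1w_1+sw_2$ 14. $(w_1z^2w_2)_{12}\mapsto w_2z^2w_1-sw_1$, $(w_1z^3w_2)_{12}\mapsto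 q^{-3}w_2z^3w_1$ 15. $(w_1z^1w_3)_{12}\mapsto w_3z^1w_1+sw_3$, $(w_1z^2w_3)_{12}\mapsto q^3w_3z^2w_1$ 16. $(w_2z^1w_3)_{12}\mapsto q^{-3}w_3z^1w_2$, $(w_2z^2w_3)_{12}\mapsto w_3z^2w_2+sw_3$ 17. $(w_3w_1z^3)_{01}\mapsto q^{-1}(t+\frac{3s}2)w_1-q^{-2}w_2w_1z^2-q^{-1}w_1w_1z^1$ 18. $(w_3w_2z^3)_{01}\mapsto q(t+\frac{3s}2)w_2-qw_2w_1z^1-qw_2w_2z^2$ A path is irreducible if it contains no tip. Right reduction repeatedly replaces the rightmost tip of a word by its value, extended linearly. For linear combinations $u,v$ of irreducible paths (of composable types), $u\star v$ is the right reduction of the concatenation $uv$. Let $I_{q,s,t}$ be the two-sided ideal of the path algebra $KQ$ generated by the essential rules, and $\Lambda_{q,s,t}=KQ/I_{q,s,t}$. **Theorem.** (a) For all $K,q,s,t$: right reduction terminates on every element of $KQ$ and does not change its class modulo $I_{q,s,t}$. The superfluous rules hold in $\Lambda_{q,s,t}$. The irreducible paths form a $K$-basis of $\Lambda_{q,s,t}$.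 The product $\star$ on the span of the irreducible paths is closed, unital (with units $e_0,e_1,e_2$) and associative. In particular, for $K=\mathbb C[[\hbar]]$ and $q=e^{\hbar/3}$, it is associative to all orders in $\hbar$. (b) For $q=1$, $s=0$ and all $K,t$, the ideal $I_{1,0,t}$ is generated by $(z^iz^j-z^jz^i)_{20}$, $(w_iw_j-w_jw_i)_{02}$, $(z^iw_j-w_jz^i)_{11}$ for all $i,j$, and by $\sum_iw_iz^i-t$ at $e_0,e_1$ and $\sum_iz^iw_i-t$ at $e_1,e_2$. Evaluating paths in $R_t=K[z^1,z^2,z^3,w_1,w_2,w_3]/(\sum_iw_iz^i-t)$ identifies $e_a\Lambda_{1,0,t}e_b$ with the part of $R_t$ of weight $a-b$, where $z^i$ has weight $1$ and $w_i$ has weight $-1$. (For $t=0$, $K=\mathbb C$ these are the spaces $H^0(T^*\mathbb P^2,\mathcal O(a-b))=\mathrm{Hom}(\mathcal O(b),\mathcal O(a))$, so that $\Lambda_{1,0,0}$ is the quiver algebra of the tilting bundle $\mathcal O\oplus\mathcal O(1)\oplus\mathcal O(2)$ on $T^*\mathbb P^2$; the parameter $t$ is the Kodaira–Spencer deformation $\sum_i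 w_iz^i=0\rightsquigarrow \sum_i w_iz^i=t$.) (c) Let $K=\mathbb C[[\hbar]]$, $q=e^{\hbar/3}$, and let $s=s_1\hbar+O(\hbar^2)$ and $t=t_0+O(\hbar)$ be power series in $\hbar$ (for example $s=s_1\hbar$, $t=t_1\hbar$). Then for all linear combinations with complex coefficients of irreducible paths, $\star$ reduces modulo $\hbar$ to the product of $\Lambda_{1,0,t_0}$. Setting $x^i=z^i/z^3$, $\xi_i=w_iz^3$ for $i=1,2$ identifies $e_0\Lambda_{1,0,t_0}e_0$ with an algebra of functions on the chart $z^3\ne0$ (an injective multiplicative map to $\mathbb C[x^1,x^2,\xi_1,\xi_2]$, with $w_3z^3=t_0-x^1\xi_1-x^2\xi_2$). In terms of these functions $$f\star g-g\star f=\hbar\,\{f,g\}_{s_1}+O(\hbar^2),$$ where $\{\cdot,\cdot\}_{s}$ is the bracket given by the bivector $$-i\Pi_{s}=s(\partial_{\xi_1}\wedge\partial_{x^1}+\partial_{\xi_2}\wedge\partial_{x^2})-\xi_1\xi_2\,\partial_{\xi_1}\wedge\partial_{\xi_2}+\xi_1x^2\,\partial_{\xi_1}\wedge\partial_{x^2}-\xi_2x^1\,\partial_{\xi_2}\wedge\partial_{x^1}-x^1x^2\,\partial_{x^1}\wedge\partial_{x^2}.$$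 -/

import Mathlib

open Quiver

namespace TP2

/-! ### The quiver -/

/-- The three nodes; `e0, e1, e2` correspond to the line bundles `O, O(1), O(2)`. -/
inductive Node : Type
  | e0 | e1 | e2

open Node

/-- The twelve arrows.  The superscript or subscript `1, 2, 3` of the letters `z` and `w` is
written as an element `0, 1, 2` of `Fin 3`. -/
inductive Arrow : Node → Node → Type
  | z01 (i : Fin 3) : Arrow e0 e1
  | z12 (i : Fin 3) : Arrow e1 e2
  | w10 (i : Fin 3) : Arrow e1 e0
  | w21 (i : Fin 3) : Arrow e2 e1

instance quiverNode : Quiver Node := ⟨Arrow⟩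

/-- The position of a node, so that `e_a` corresponds to `O(a)`. -/
def Node.pos : Node → ℤ
  | e0 => 0
  | e1 => 1
  | e2 => 2

/-- An arrow, as a morphism of the quiver. -/
def Arrow.hom {a b : Node} (x : Arrow a b) : a ⟶ b := x

/-- The path consisting of `x` followed by `y`; as a word it is written `y x`. -/
def path2 {a b c : Node} (x : Arrow a b) (y : Arrow b c) : Path a c :=
  (Path.nil.cons x.hom).cons y.hom

/-- The path consisting of `x`, then `y`, then `u`; as a word it is written `u y x`. -/
def path3 {a b c d : Node} (x : Arrow a b) (y : Arrow b c) (u : Arrow c d) : Path a d :=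
  (path2 x y).cons u.hom

/-! Words are read from right to left: the rightmost letter is the first arrow of the path. -/

/-- `e₂ z^i z^j e₀` -/
def zz (i j : Fin 3) : Path e0 e2 := path2 (.z01 j) (.z12 i)
/-- `e₀ w_i w_j e₂` -/
def ww (i j : Fin 3) : Path e2 e0 := path2 (.w21 j) (.w10 i)
/-- `e₁ z^i w_j e₁` -/
def zw11 (i j : Fin 3) : Path e1 e1 := path2 (.w10 j) (.z01 i)
/-- `e₁ w_i z^j e₁` -/
def wz11 (i j : Fin 3) : Path e1 e1 := path2 (.z12 j) (.w21 i)
/-- `e₂ z^i w_j e₂` -/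
def zw22 (i j : Fin 3) : Path e2 e2 := path2 (.w21 j) (.z12 i)
/-- `e₀ w_i z^j e₀` -/
def wz00 (i j : Fin 3) : Path e0 e0 := path2 (.z01 j) (.w10 i)
/-- `e₂ z^i w_j z^k e₁` -/
def zwz (i j k : Fin 3) : Path e1 e2 := path3 (.z12 k) (.w21 j) (.z12 i)
/-- `e₁ w_i z^j w_k e₂` -/
def wzw (i j k : Fin 3) : Path e2 e1 := path3 (.w21 k) (.z12 j) (.w21 i)
/-- `e₀ w_i w_j z^k e₁` -/
def wwz (i j k : Fin 3) : Path e1 e0 := path3 (.z12 k) (.w21 j) (.w10 i)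
/-- `e₂ z^i e₁` -/
def z21 (i : Fin 3) : Path e1 e2 := Path.nil.cons (Arrow.z12 i).hom
/-- `e₁ w_i e₂` -/
def w12 (i : Fin 3) : Path e2 e1 := Path.nil.cons (Arrow.w21 i).hom
/-- `e₀ w_i e₁` -/
def w01 (i : Fin 3) : Path e1 e0 := Path.nil.cons (Arrow.w10 i).hom
/-- The idempotent `e_a`, i.e. the path of length zero at `a`. -/
def idp (a : Node) : Path a a := Path.nil

/-- `e_b (K Q) e_a`: formal `K`-linear combinations of paths from `a` to `b`. -/
abbrev Lin (K : Type*) [CommRing K] (a b : Node) : Type _ := Path a b →₀ K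

/-- The three parameters; `q` is invertible. -/
structure Params (K : Type*) [CommRing K] where
  q : Kˣ
  s : K
  t : K

noncomputable section

/-! ### The deformed reduction system -/

section Rules

variable {K : Type*} [CommRing K] [Algebra ℂ K] (P : Params K)

/-- `c • p` -/
abbrev mon {a b : Node} (c : K) (p : Path a b) : Lin K a b := Finsupp.single p c

/-- `q` as an element of `K`. -/
def Params.Q : K := (P.q : K)
/-- `q⁻¹` as an element of `K`. -/
def Params.Qi : K := ((P.q⁻¹ : Kˣ) : K)
/-- `t + r s` for a constant `r`. -/
def Params.ts (r : ℂ) : K := P.t + algebraMap ℂ K r * P.s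

/-- Rules for `(z^i z^j)_{20}`. -/
def ruleZZ : Fin 3 → Fin 3 → Option (Lin K e0 e2)
  | 0, 1 => some (mon P.Qi (zz 1 0))
  | 1, 2 => some (mon P.Qi (zz 2 1))
  | 0, 2 => some (mon P.Q (zz 2 0))
  | _, _ => none

/-- Rules for `(w_i w_j)_{02}`. -/
def ruleWW : Fin 3 → Fin 3 → Option (Lin K e2 e0)
  | 0, 1 => some (mon P.Qi (ww 1 0))
  | 1, 2 => some (mon P.Qi (ww 2 1))
  | 0, 2 => some (mon P.Q (ww 2 0))
  | _, _ => none

/-- Rules for `(z^i w_j)_{11}`. -/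
def ruleZW11 : Fin 3 → Fin 3 → Option (Lin K e1 e1)
  | 0, 1 => some (mon P.Q (wz11 1 0))
  | 0, 2 => some (mon P.Qi (wz11 2 0))
  | 1, 2 => some (mon P.Q (wz11 2 1))
  | 1, 0 => some (mon P.Qi (wz11 0 1))
  | 2, 0 => some (mon P.Q (wz11 0 2))
  | 2, 1 => some (mon P.Qi (wz11 1 2))
  | 0, 0 => some (mon 1 (wz11 0 0) - mon P.s (idp e1))
  | 1, 1 => some (mon 1 (wz11 1 1) - mon P.s (idp e1))
  | 2, 2 => some (-mon 1 (wz11 0 0) - mon 1 (wz11 1 1) + mon (P.ts (1 / 2)) (idp e1))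

/-- Rule for `(w_3 z^3)_{11}`. -/
def ruleWZ11 : Fin 3 → Fin 3 → Option (Lin K e1 e1)
  | 2, 2 => some (-mon 1 (wz11 0 0) - mon 1 (wz11 1 1) + mon (P.ts (3 / 2)) (idp e1))
  | _, _ => none

/-- Rule for `(w_3 z^3)_{00}`. -/
def ruleWZ00 : Fin 3 → Fin 3 → Option (Lin K e0 e0)
  | 2, 2 => some (-mon 1 (wz00 0 0) - mon 1 (wz00 1 1) + mon (P.ts (1 / 2)) (idp e0))
  | _, _ => none

/-- Rule for `(z^3 w_3)_{22}`. -/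
def ruleZW22 : Fin 3 → Fin 3 → Option (Lin K e2 e2)
  | 2, 2 => some (-mon 1 (zw22 0 0) - mon 1 (zw22 1 1) + mon (P.ts (-(1 / 2))) (idp e2))
  | _, _ => none

/-- Superfluous rules for `(z^i w_j z^k)_{21}`. -/
def ruleZWZ : Fin 3 → Fin 3 → Fin 3 → Option (Lin K e1 e2)
  | 0, 0, 1 => some (mon 1 (zwz 1 0 0) - mon P.s (z21 1))
  | 0, 1, 1 => some (mon 1 (zwz 1 1 0) + mon P.s (z21 0))
  | 0, 2, 1 => some (mon (P.Qi ^ 3) (zwz 1 2 0))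
  | 0, 0, 2 => some (mon 1 (zwz 2 0 0) - mon P.s (z21 2))
  | 0, 1, 2 => some (mon (P.Q ^ 3) (zwz 2 1 0))
  | 1, 0, 2 => some (mon (P.Qi ^ 3) (zwz 2 0 1))
  | 1, 1, 2 => some (mon 1 (zwz 2 1 1) - mon P.s (z21 2))
  | _, _, _ => none

/-- Superfluous rules for `(w_i z^j w_k)_{12}`. -/
def ruleWZW : Fin 3 → Fin 3 → Fin 3 → Option (Lin K e2 e1)
  | 0, 0, 1 => some (mon 1 (wzw 1 0 0) + mon P.s (w12 1))
  | 0, 1, 1 => some (mon 1 (wzw 1 1 0) - mon P.s (w12 0))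
  | 0, 2, 1 => some (mon (P.Qi ^ 3) (wzw 1 2 0))
  | 0, 0, 2 => some (mon 1 (wzw 2 0 0) + mon P.s (w12 2))
  | 0, 1, 2 => some (mon (P.Q ^ 3) (wzw 2 1 0))
  | 1, 0, 2 => some (mon (P.Qi ^ 3) (wzw 2 0 1))
  | 1, 1, 2 => some (mon 1 (wzw 2 1 1) + mon P.s (w12 2))
  | _, _, _ => none

/-- Superfluous rules for `(w_i w_j z^k)_{01}`. -/
def ruleWWZ : Fin 3 → Fin 3 → Fin 3 → Option (Lin K e1 e0)
  | 2, 0, 2 => some (mon (P.Qi * P.ts (3 / 2)) (w01 0) - mon (P.Qi ^ 2) (wwz 1 0 1)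
      - mon P.Qi (wwz 0 0 0))
  | 2, 1, 2 => some (mon (P.Q * P.ts (3 / 2)) (w01 1) - mon P.Q (wwz 1 0 0)
      - mon P.Q (wwz 1 1 1))
  | _, _, _ => none

/-- The essential rules (all tips of length two): the value of the word `y x`, if it is a tip. -/
def rule2 : ∀ {a b c : Node}, Arrow a b → Arrow b c → Option (Lin K a c)
  | _, _, _, .z01 j, .z12 i => ruleZZ P i j
  | _, _, _, .w21 j, .w10 i => ruleWW P i j
  | _, _, _, .w10 j, .z01 i => ruleZW11 P i j
  | _, _, _, .z12 j, .w21 i => ruleWZ11 P i j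
  | _, _, _, .z01 j, .w10 i => ruleWZ00 P i j
  | _, _, _, .w21 j, .z12 i => ruleZW22 P i j

/-- The superfluous rules (all tips of length three): the value of the word `u y x`, if it is
a tip. -/
def rule3 : ∀ {a b c d : Node}, Arrow a b → Arrow b c → Arrow c d → Option (Lin K a d)
  | _, _, _, _, .z12 k, .w21 j, .z12 i => ruleZWZ P i j k
  | _, _, _, _, .w21 k, .z12 j, .w21 i => ruleWZW P i j k
  | _, _, _, _, .z12 k, .w21 j, .w10 i => ruleWWZ P i j k
  | _, _, _, _, _, _, _ => none

/-! ### Right reduction and the star product -/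

/-- If the word `p` begins (on its left) with a tip, replace that tip. -/
def topRule : ∀ {a b : Node}, Path a b → Option (Lin K a b)
  | _, _, .nil => none
  | _, _, .cons .nil _ => none
  | _, _, .cons (.cons .nil x) y => rule2 P x y
  | _, _, .cons (.cons (.cons p x) y) u =>
    match rule2 P y u with
    | some f => some (f.mapDomain fun r => (p.cons x).comp r)
    | none => (rule3 P x y u).map fun f => f.mapDomain fun r => p.comp r

/-- Replace the rightmost tip of a word; `none` if the word contains no tip. -/
def rightStep : ∀ {a b : Node}, Path a b → Option (Lin K a b)
  | _, _, .nil => none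
  | _, _, .cons p x =>
    match rightStep p with
    | some f => some (f.mapDomain fun r => r.cons x)
    | none => topRule P (p.cons x)

/-- Linear combinations of irreducible paths, that is, of paths containing no tip. -/
def irr (a b : Node) : Submodule K (Lin K a b) :=
  Finsupp.supported K K {p | rightStep P p = none}

/-- One step of right reduction, on every path of a linear combination. -/
def redStep (a b : Node) : Lin K a b →ₗ[K] Lin K a b :=
  Finsupp.linearCombination K fun p => (rightStep P p).getD (mon 1 p)

open Classical in
/-- Right reduction: reduce from the right until only irreducible paths are left.
(If this never happened the value would be `0`.) -/
def redR {a b : Node} (f : Lin K a b) : Lin K a b :=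
  if h : ∃ n : ℕ, (redStep P a b)^[n] f ∈ irr P a b then (redStep P a b)^[Nat.find h] f else 0

/-- Concatenation `u v` (first `v`, then `u`), the product of the path algebra. -/
def concat {a b c : Node} (u : Lin K b c) (v : Lin K a b) : Lin K a c :=
  v.sum fun p x => u.sum fun r y => mon (y * x) (p.comp r)

/-- The star product: concatenate, then apply right reduction. -/
def star {a b c : Node} (u : Lin K b c) (v : Lin K a b) : Lin K a c := redR P (concat u v)

/-! ### Ideals of relations -/

/-- The two-sided ideal of the path algebra generated by a family of relations. -/
def relIdeal (R : ∀ a b : Node, Set (Lin K a b)) (a b : Node) : Submodule K (Lin K a b) :=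
  Submodule.span K {f | ∃ (c d : Node) (v : Path a c) (r : Lin K c d) (u : Path d b),
    r ∈ R c d ∧ f = concat (mon 1 u) (concat r (mon 1 v))}

/-- The relations given by the essential rules. -/
def essRel (a b : Node) : Set (Lin K a b) :=
  {r | ∃ (c : Node) (x : Arrow a c) (y : Arrow c b) (f : Lin K a b),
    rule2 P x y = some f ∧ r = mon 1 (path2 x y) - f}

/-- The relations given by the superfluous rules. -/
def supRel (a b : Node) : Set (Lin K a b) :=
  {r | ∃ (c d : Node) (x : Arrow a c) (y : Arrow c d) (u : Arrow d b) (f : Lin K a b),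
    rule3 P x y u = some f ∧ r = mon 1 (path3 x y u) - f}

end Rules

/-! ### The quiver relations and the geometric model -/

section Geometry

variable {K : Type*} [CommRing K]

/-- The relations of the quiver: `z`'s commute, `w`'s commute, `z`'s commute with `w`'s at `e₁`,
and `∑ w_i z^i = t`, `∑ z^i w_i = t` at every node.  The undeformed case is `t = 0`. -/
def quiverRel (t : K) : ∀ a b : Node, Set (Lin K a b)
  | e0, e2 => {r | ∃ i j, r = mon 1 (zz i j) - mon 1 (zz j i)}
  | e2, e0 => {r | ∃ i j, r = mon 1 (ww i j) - mon 1 (ww j i)}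
  | e1, e1 => {r | (∃ i j, r = mon 1 (zw11 i j) - mon 1 (wz11 j i)) ∨
      r = ∑ i, mon 1 (zw11 i i) - mon t (idp e1) ∨ r = ∑ i, mon 1 (wz11 i i) - mon t (idp e1)}
  | e0, e0 => {r | r = ∑ i, mon 1 (wz00 i i) - mon t (idp e0)}
  | e2, e2 => {r | r = ∑ i, mon 1 (zw22 i i) - mon t (idp e2)}
  | _, _ => ∅

/-- The value of an arrow when `z^i` and `w_i` are given commuting values. -/
def Arrow.val {R : Type*} (ζ ω : Fin 3 → R) : ∀ {a b : Node}, Arrow a b → R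
  | _, _, .z01 i => ζ i
  | _, _, .z12 i => ζ i
  | _, _, .w10 i => ω i
  | _, _, .w21 i => ω i

/-- The value of a path: the product of the values of its arrows. -/
def evalPath {R : Type*} [CommRing R] (ζ ω : Fin 3 → R) : ∀ {a b : Node}, Path a b → R
  | _, _, .nil => 1
  | _, _, .cons p x => Arrow.val ζ ω x * evalPath ζ ω p

/-- The linear extension of `evalPath`. -/
def evalLin {R : Type*} [CommRing R] [Algebra K R] (ζ ω : Fin 3 → R) (a b : Node) :
    Lin K a b →ₗ[K] R :=
  Finsupp.linearCombination K fun p => evalPath ζ ω p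

/-- The coordinate ring `K[z¹,z²,z³,w₁,w₂,w₃] / (∑ w_i z^i - t)`;
`Sum.inl i` stands for `z^i` and `Sum.inr i` for `w_i`. -/
abbrev Coord (t : K) : Type _ :=
  MvPolynomial (Fin 3 ⊕ Fin 3) K ⧸ Ideal.span
    {∑ i : Fin 3, MvPolynomial.X (R := K) (Sum.inr i : Fin 3 ⊕ Fin 3)
      * MvPolynomial.X (Sum.inl i) - MvPolynomial.C t}

/-- `z^i` in the coordinate ring. -/
def coordZ (t : K) (i : Fin 3) : Coord t := Ideal.Quotient.mk _ (MvPolynomial.X (Sum.inl i))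
/-- `w_i` in the coordinate ring. -/
def coordW (t : K) (i : Fin 3) : Coord t := Ideal.Quotient.mk _ (MvPolynomial.X (Sum.inr i))

/-- The part of weight `d` of the coordinate ring for the scaling `z ↦ λ z`, `w ↦ λ⁻¹ w`:
the sections of `O(d)` on the quotient of `{z ≠ 0, ∑ w_i z^i = t}` by this scaling, which is
`T*ℙ²` for `t = 0`. -/
def weightPart (t : K) (d : ℤ) : Submodule K (Coord t) :=
  (MvPolynomial.weightedHomogeneousSubmodule K
    (Sum.elim (fun _ => (1 : ℤ)) (fun _ => -1) : Fin 3 ⊕ Fin 3 → ℤ) d).map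
    (Ideal.Quotient.mkₐ K _).toLinearMap

/-- Functions on the chart `z³ ≠ 0`: polynomials in `x^i = z^i / z³` and `ξ_i = w_i z³`,
`i = 1, 2`. -/
abbrev Chart : Type := MvPolynomial (Fin 2 ⊕ Fin 2) ℂ

/-- The coordinate `x^i` (`i = 1, 2` written as `0, 1`). -/
def cx (i : Fin 2) : Chart := MvPolynomial.X (Sum.inl i)
/-- The coordinate `ξ_i` (`i = 1, 2` written as `0, 1`). -/
def cξ (i : Fin 2) : Chart := MvPolynomial.X (Sum.inr i)

/-- A combination of paths from `e₀` to `e₀`, as a function on the chart `z³ ≠ 0` of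
`∑ w_i z^i = t`. -/
def chart (t : ℂ) : Lin ℂ e0 e0 →ₗ[ℂ] Chart :=
  evalLin ![cx 0, cx 1, 1]
    ![cξ 0, cξ 1, MvPolynomial.C t - cx 0 * cξ 0 - cx 1 * cξ 1] e0 e0

/-- `(∂_u ∧ ∂_v)(f, g)` -/
def wedge (u v : Fin 2 ⊕ Fin 2) (f g : Chart) : Chart :=
  MvPolynomial.pderiv u f * MvPolynomial.pderiv v g
    - MvPolynomial.pderiv v f * MvPolynomial.pderiv u g

/-- The Poisson bracket of the bivector
`s (∂_{ξ₁}∧∂_{x¹} + ∂_{ξ₂}∧∂_{x²}) - ξ₁ξ₂ ∂_{ξ₁}∧∂_{ξ₂} + ξ₁x² ∂_{ξ₁}∧∂_{x²}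
- ξ₂x¹ ∂_{ξ₂}∧∂_{x¹} - x¹x² ∂_{x¹}∧∂_{x²}`. -/
def poisson (s : ℂ) (f g : Chart) : Chart :=
  MvPolynomial.C s * (wedge (.inr 0) (.inl 0) f g + wedge (.inr 1) (.inl 1) f g)
    - cξ 0 * cξ 1 * wedge (.inr 0) (.inr 1) f g
    + cξ 0 * cx 1 * wedge (.inr 0) (.inl 1) f g
    - cξ 1 * cx 0 * wedge (.inr 1) (.inl 0) f g
    - cx 0 * cx 1 * wedge (.inl 0) (.inl 1) f g

end Geometry

/-! ### The formal parameter `ħ` -/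

/-- The formal power series `exp (r ħ)`. -/
def expSeries (r : ℂ) : PowerSeries ℂ := PowerSeries.rescale r (PowerSeries.exp ℂ)

theorem expSeries_mul_neg (r : ℂ) : expSeries r * expSeries (-r) = 1 := by
  have h := congrArg (PowerSeries.rescale r) (PowerSeries.exp_mul_exp_neg_eq_one (A := ℂ))
  rw [map_mul, map_one, PowerSeries.evalNegHom, PowerSeries.rescale_rescale] at h
  simpa [expSeries] using h

/-- `q = exp (ħ / 3)` -/
def qHbar : (PowerSeries ℂ)ˣ where
  val := expSeries (1 / 3)
  inv := expSeries (-(1 / 3))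
  val_inv := expSeries_mul_neg _
  inv_val := by rw [mul_comm]; exact expSeries_mul_neg _

/-- Extension of scalars from `ℂ` to `ℂ⟦ħ⟧`. -/
def extend {a b : Node} (f : Lin ℂ a b) : Lin (PowerSeries ℂ) a b :=
  f.mapRange (PowerSeries.C (R := ℂ)) (map_zero _)

/-- The coefficient of `ħ ^ n`. -/
def hcoeff (n : ℕ) {a b : Node} (f : Lin (PowerSeries ℂ) a b) : Lin ℂ a b :=
  f.mapRange (PowerSeries.coeff (R := ℂ) n) (map_zero _)

end

end TP2

set_option linter.unusedSectionVars false

namespace TP2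

open Node

universe u v

/-! ### Bilinearity and associativity of concatenation; two-sided ideals of the path algebra -/

section Concat

variable {K : Type u} [CommRing K]

/-! Termination holds because every rule decreases a well-founded order on words. It shows only that
irreducible paths span the quotient; the real issue is their independence. Overlapping tips are not
resolved one by one. Instead the quotient is represented faithfully by q-difference-differential
operators on `K[x¹,x²,ξ₁,ξ₂]`, the functions on the chart z³ = 1. Here z³ acts as the identity, z¹
and z² as multiplication by x¹ and x² after a torus dilation by powers of q, and w₁ and w₂ as ξ_i +
s ∂_{x^i} after the inverse dilation. The operator of w₃ is solved from ∑ z^i w_i = κ, with κ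
depending on the node. The dilations produce the powers of q, and the Heisenberg commutator produces
the shifts by s (`opLin_rule2`).

Applied to the constant 1, the operator of a path is a polynomial with a leading monomial whose
coefficient is a unit (`opPath_one_lead`), and different irreducible paths have different leading
monomials (`eq_of_lead_eq`). Hence an irreducible combination with zero symbol vanishes, over any K.
Together with termination this makes irreducible combinations a complement of the ideal
(`isCompl_irr_essIdeal`) and the ideal the kernel of the symbol (`mem_essIdeal_iff`). Associativity
of the star product is then associativity in the quotient.

At q = 1, s = 0 the operators are multiplications and the symbol is evaluation on the chart. This
identifies the ideal with that of the quiver relations and with the kernel of evaluation in the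
coordinate ring; the image is found by writing each monomial of the right weight as a path.

For q = exp(ħ/3), the operator of a path modulo ħ² is f + ħ(D + h), with f and h multiplication
operators and D a derivation (`c0_c1_opPath`). In a commutator applied to 1 the functions h cancel,
leaving D_f g − D_g f. This is the Poisson bracket for single arrows by computation and for all
paths by the Leibniz rule (`bracket_path`). -/

theorem concat_zero_left {a b c : Node} (v : Lin K a b) : concat (0 : Lin K b c) v = 0 := by
  simp [concat]

theorem concat_zero_right {a b c : Node} (u : Lin K b c) : concat u (0 : Lin K a b) = 0 := by
  simp [concat]

theorem concat_single {a b c : Node} (p : Path a b) (r : Path b c) (x y : K) :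
    concat (mon y r) (mon x p) = mon (y * x) (p.comp r) := by
  simp [concat]

theorem concat_add_left {a b c : Node} (u u' : Lin K b c) (v : Lin K a b) :
    concat (u + u') v = concat u v + concat u' v := by
  unfold concat
  rw [← Finsupp.sum_add]
  refine Finsupp.sum_congr fun p _ => ?_
  exact Finsupp.sum_add_index' (by simp) (by intros; simp [add_mul, mon])

theorem concat_add_right {a b c : Node} (u : Lin K b c) (v v' : Lin K a b) :
    concat u (v + v') = concat u v + concat u v' := by
  unfold concat
  refine Finsupp.sum_add_index' (by simp) fun p x x' => ?_
  rw [← Finsupp.sum_add]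
  exact Finsupp.sum_congr fun r _ => by simp [mul_add, mon]

theorem concat_smul_left {a b c : Node} (k : K) (u : Lin K b c) (v : Lin K a b) :
    concat (k • u) v = k • concat u v := by
  induction v using Finsupp.induction_linear with
  | zero => simp [concat_zero_right]
  | add v v' h h' => rw [concat_add_right, concat_add_right, h, h', smul_add]
  | single p x =>
    induction u using Finsupp.induction_linear with
    | zero => simp [concat_zero_left]
    | add u u' h h' => rw [smul_add, concat_add_left, concat_add_left, h, h', smul_add]
    | single r y => rw [Finsupp.smul_single, concat_single, concat_single, Finsupp.smul_single,
        smul_eq_mul, smul_eq_mul, mul_assoc]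

theorem concat_smul_right {a b c : Node} (k : K) (u : Lin K b c) (v : Lin K a b) :
    concat u (k • v) = k • concat u v := by
  induction u using Finsupp.induction_linear with
  | zero => simp [concat_zero_left]
  | add u u' h h' => rw [concat_add_left, concat_add_left, h, h', smul_add]
  | single r y =>
    induction v using Finsupp.induction_linear with
    | zero => simp [concat_zero_right]
    | add u u' h h' => rw [smul_add, concat_add_right, concat_add_right, h, h', smul_add]
    | single p x => rw [Finsupp.smul_single, concat_single, concat_single, Finsupp.smul_single,
        smul_eq_mul, smul_eq_mul, mul_left_comm]

/-- Concatenation as a bilinear map. -/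
noncomputable def concatB (a b c : Node) : Lin K b c →ₗ[K] Lin K a b →ₗ[K] Lin K a c :=
  LinearMap.mk₂ K concat concat_add_left concat_smul_left concat_add_right concat_smul_right

theorem concatB_apply {a b c : Node} (u : Lin K b c) (v : Lin K a b) :
    concatB a b c u v = concat u v := rfl

theorem concat_sub_left {a b c : Node} (u u' : Lin K b c) (v : Lin K a b) :
    concat (u - u') v = concat u v - concat u' v := by
  simp only [← concatB_apply, map_sub, LinearMap.sub_apply]

theorem concat_sub_right {a b c : Node} (u : Lin K b c) (v v' : Lin K a b) :
    concat u (v - v') = concat u v - concat u v' := by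
  simp only [← concatB_apply, map_sub]

theorem concat_neg_right {a b c : Node} (u : Lin K b c) (v : Lin K a b) :
    concat u (-v) = -concat u v := by
  simp only [← concatB_apply, map_neg]

theorem concat_assoc {a b c d : Node} (u : Lin K c d) (v : Lin K b c) (w : Lin K a b) :
    concat (concat u v) w = concat u (concat v w) := by
  induction u using Finsupp.induction_linear with
  | zero => simp [concat_zero_left]
  | add u u' h h' => simp only [concat_add_left, h, h']
  | single r y =>
    induction v using Finsupp.induction_linear with
    | zero => simp [concat_zero_left, concat_zero_right]
    | add u u' h h' => simp only [concat_add_left, concat_add_right, h, h']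
    | single p x =>
      induction w using Finsupp.induction_linear with
      | zero => simp [concat_zero_right]
      | add u u' h h' => simp only [concat_add_right, h, h']
      | single s z => simp only [concat_single, mul_assoc, Path.comp_assoc]

theorem concat_idp_right {a b : Node} (u : Lin K a b) : concat u (mon 1 (idp a)) = u := by
  induction u using Finsupp.induction_linear with
  | zero => exact concat_zero_left _
  | add u u' h h' => rw [concat_add_left, h, h']
  | single r y => rw [concat_single, mul_one, idp, Path.nil_comp]

theorem concat_idp_left {a b : Node} (u : Lin K a b) : concat (mon 1 (idp b)) u = u := by
  induction u using Finsupp.induction_linear with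
  | zero => exact concat_zero_right _
  | add u u' h h' => rw [concat_add_right, h, h']
  | single r y => rw [concat_single, one_mul, idp, Path.comp_nil]

/-- `rightStep` extends a reduction to a longer word by `mapDomain`. Seen as a product in the path
algebra, this operation preserves the ideal. -/
theorem mapDomain_cons_eq_concat {a b c : Node} (f : Lin K a b) (x : b ⟶ c) :
    (f.mapDomain fun r => r.cons x) = concat (mon 1 x.toPath) f := by
  induction f using Finsupp.induction_linear with
  | zero => simp [concat_zero_right]
  | add u u' h h' => rw [concat_add_right, Finsupp.mapDomain_add, h, h']
  | single r y => rw [concat_single, one_mul, Finsupp.mapDomain_single]; rfl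

theorem mapDomain_comp_eq_concat {a b c : Node} (f : Lin K b c) (p : Path a b) :
    (f.mapDomain fun r => p.comp r) = concat f (mon 1 p) := by
  induction f using Finsupp.induction_linear with
  | zero => simp [concat_zero_left]
  | add u u' h h' => rw [concat_add_left, Finsupp.mapDomain_add, h, h']
  | single r y => rw [concat_single, mul_one, Finsupp.mapDomain_single]

section Ideal

variable {R : ∀ a b : Node, Set (Lin K a b)}

theorem relIdeal_le {a b : Node} {N : Submodule K (Lin K a b)}
    (h : ∀ (c d : Node) (v : Path a c) (r : Lin K c d) (u : Path d b), r ∈ R c d →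
      concat (mon 1 u) (concat r (mon 1 v)) ∈ N) : relIdeal R a b ≤ N := by
  refine Submodule.span_le.2 ?_
  rintro _ ⟨c, d, v, r, u, hr, rfl⟩
  exact h c d v r u hr

theorem subset_relIdeal {a b : Node} {r : Lin K a b} (hr : r ∈ R a b) : r ∈ relIdeal R a b :=
  Submodule.subset_span ⟨a, b, idp a, r, idp b, hr, by rw [concat_idp_left, concat_idp_right]⟩

theorem concat_mem_relIdeal_left {a b c : Node} (u : Lin K b c) {f : Lin K a b}
    (hf : f ∈ relIdeal R a b) : concat u f ∈ relIdeal R a c := by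
  induction u using Finsupp.induction_linear with
  | zero => rw [concat_zero_left]; exact zero_mem _
  | add u u' h h' => rw [concat_add_left]; exact add_mem h h'
  | single p x =>
    have : relIdeal R a b ≤ (relIdeal R a c).comap (concatB a b c (Finsupp.single p x)) := by
      refine relIdeal_le fun d e v r w hr => ?_
      rw [Submodule.mem_comap, concatB_apply, ← concat_assoc, concat_single,
        mul_one]
      have : mon x (w.comp p) = x • (mon 1 (w.comp p) : Lin K e c) := by simp
      rw [this, concat_smul_left]
      exact Submodule.smul_mem _ _ (Submodule.subset_span ⟨_, _, v, r, _, hr, rfl⟩)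
    exact this hf

theorem concat_mem_relIdeal_right {a b c : Node} (u : Lin K a b) {f : Lin K b c}
    (hf : f ∈ relIdeal R b c) : concat f u ∈ relIdeal R a c := by
  induction u using Finsupp.induction_linear with
  | zero => rw [concat_zero_right]; exact zero_mem _
  | add u u' h h' => rw [concat_add_right]; exact add_mem h h'
  | single p x =>
    have : relIdeal R b c ≤
        (relIdeal R a c).comap ((concatB a b c).flip (Finsupp.single p x)) := by
      refine relIdeal_le fun d e v r w hr => ?_
      rw [Submodule.mem_comap, LinearMap.flip_apply, concatB_apply, concat_assoc, concat_assoc,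
        concat_single, one_mul]
      have : mon x (p.comp v) = x • (mon 1 (p.comp v) : Lin K a d) := by simp
      rw [this, concat_smul_right, concat_smul_right]
      exact Submodule.smul_mem _ _ (Submodule.subset_span ⟨_, _, _, r, _, hr, rfl⟩)
    exact this hf

theorem relIdeal_mono {R' : ∀ a b : Node, Set (Lin K a b)}
    (h : ∀ a b, R a b ⊆ (relIdeal R' a b : Set (Lin K a b))) (a b : Node) :
    relIdeal R a b ≤ relIdeal R' a b :=
  relIdeal_le fun _ _ _ _ _ hr =>
    concat_mem_relIdeal_left _ (concat_mem_relIdeal_right _ (h _ _ hr))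

end Ideal

end Concat

/-! ### Termination -/

section Termination

/-- The index of the letter of an arrow. -/
def Arrow.idx : ∀ {a b : Node}, Arrow a b → Fin 3
  | _, _, .z01 i => i
  | _, _, .z12 i => i
  | _, _, .w10 i => i
  | _, _, .w21 i => i

/-- Whether an arrow ends at `e₀`. -/
def Arrow.toZero : ∀ {a b : Node}, Arrow a b → ℕ
  | _, _, .w10 _ => 1
  | _, _, _ => 0

/-- The length of a path. -/
def len {a : Node} : ∀ {b : Node}, Path a b → ℕ
  | _, .nil => 0
  | _, .cons p _ => len p + 1

/-- The number of times a path arrives at `e₀`. -/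
def visits {a : Node} : ∀ {b : Node}, Path a b → ℕ
  | _, .nil => 0
  | _, .cons p x => visits p + Arrow.toZero x

/-- The number of letters of index `3`. -/
def threes {a : Node} : ∀ {b : Node}, Path a b → ℕ
  | _, .nil => 0
  | _, .cons p x => threes p + if Arrow.idx x = 2 then 1 else 0

/-- The sum of the indices of the letters. -/
def idxSum {a : Node} : ∀ {b : Node}, Path a b → ℕ
  | _, .nil => 0
  | _, .cons p x => idxSum p + (Arrow.idx x : ℕ)

/-- The sum of the indices of the letters of all proper initial segments. -/
def disorder {a : Node} : ∀ {b : Node}, Path a b → ℕ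
  | _, .nil => 0
  | _, .cons p _ => disorder p + idxSum p

/-- The order on words for which every reduction rule is decreasing. -/
def Less {a b : Node} (r p : Path a b) : Prop :=
  len r < len p ∨ len r = len p ∧ (visits r < visits p ∨ visits r = visits p ∧
    (threes r < threes p ∨ threes r = threes p ∧
      (idxSum r = idxSum p ∧ disorder r < disorder p)))

instance {a b : Node} (r p : Path a b) : Decidable (Less r p) :=
  inferInstanceAs (Decidable (_ ∨ _))

/-- Forgetting the index sum leaves a lexicographic comparison of four natural numbers. -/
theorem wellFounded_less (a b : Node) : WellFounded (Less : Path a b → Path a b → Prop) := by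
  let f : Path a b → ℕ ×ₗ ℕ ×ₗ ℕ ×ₗ ℕ := fun p =>
    toLex (len p, toLex (visits p, toLex (threes p, disorder p)))
  refine Subrelation.wf (r := InvImage (· < ·) f) ?_ (InvImage.wf f wellFounded_lt)
  intro r p h
  simp only [InvImage, f, Prod.Lex.toLex_lt_toLex]
  unfold Less at h
  tauto

theorem len_comp {a b c : Node} (q : Path a b) (p : Path b c) :
    len (q.comp p) = len q + len p := by
  induction p with
  | nil => rw [Path.comp_nil]; rfl
  | cons p x h => rw [Path.comp_cons, len, len, h, add_assoc]

theorem visits_comp {a b c : Node} (q : Path a b) (p : Path b c) :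
    visits (q.comp p) = visits q + visits p := by
  induction p with
  | nil => rw [Path.comp_nil]; rfl
  | cons p x h => rw [Path.comp_cons, visits, visits, h, add_assoc]

theorem threes_comp {a b c : Node} (q : Path a b) (p : Path b c) :
    threes (q.comp p) = threes q + threes p := by
  induction p with
  | nil => rw [Path.comp_nil]; rfl
  | cons p x h => rw [Path.comp_cons, threes, threes, h, add_assoc]

theorem idxSum_comp {a b c : Node} (q : Path a b) (p : Path b c) :
    idxSum (q.comp p) = idxSum q + idxSum p := by
  induction p with
  | nil => rw [Path.comp_nil]; rfl
  | cons p x h => rw [Path.comp_cons, idxSum, idxSum, h, add_assoc]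

theorem disorder_comp {a b c : Node} (q : Path a b) (p : Path b c) :
    disorder (q.comp p) = disorder q + disorder p + len p * idxSum q := by
  induction p with
  | nil => rw [Path.comp_nil]; simp [disorder, len]
  | cons p x h => rw [Path.comp_cons, disorder, disorder, len, h, idxSum_comp]; ring

theorem Less.comp_left {a b c : Node} (q : Path a b) {r p : Path b c} (h : Less r p) :
    Less (q.comp r) (q.comp p) := by
  unfold Less at h ⊢
  simp only [len_comp, visits_comp, threes_comp, idxSum_comp, disorder_comp]
  rcases h with h | ⟨h1, h⟩
  · omega
  -- The term `len p * idxSum q` of `disorder_comp` is nonlinear; with equal lengths it is the same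
  -- atom on both sides.
  · rw [h1]; omega

/-- Appending a letter adds the index sum of the word to its disorder. This is why the last clause
of `Less` demands equal index sums. -/
theorem Less.cons {a b c : Node} {r p : Path a b} (h : Less r p) (x : b ⟶ c) :
    Less (r.cons x) (p.cons x) := by
  unfold Less at h ⊢
  simp only [len, visits, threes, idxSum, disorder]
  omega

variable {K : Type u} [CommRing K]

/-- Combinations of words which are smaller than `p`. -/
def below (K : Type u) [CommRing K] {a b : Node} (p : Path a b) : Submodule K (Lin K a b) :=
  Finsupp.supported K K {r | Less r p}

theorem single_mem_below {a b : Node} {r p : Path a b} (h : Less r p) (c : K) :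
    Finsupp.single r c ∈ below K p :=
  Finsupp.single_mem_supported K c h

theorem below_cons {a b c : Node} {p : Path a b} {f : Lin K a b} (h : f ∈ below K p)
    (x : b ⟶ c) : (f.mapDomain fun r => r.cons x) ∈ below K (p.cons x) := by
  classical
  refine (Finsupp.mem_supported _ _).2 fun r hr => ?_
  obtain ⟨s, hs, rfl⟩ := Finset.mem_image.1 (Finsupp.mapDomain_support hr)
  exact Less.cons ((Finsupp.mem_supported _ _).1 h hs) x

theorem below_comp {a b c : Node} {p : Path b c} {f : Lin K b c} (h : f ∈ below K p)
    (q : Path a b) : (f.mapDomain fun r => q.comp r) ∈ below K (q.comp p) := by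
  classical
  refine (Finsupp.mem_supported _ _).2 fun r hr => ?_
  obtain ⟨s, hs, rfl⟩ := Finset.mem_image.1 (Finsupp.mapDomain_support hr)
  exact Less.comp_left q ((Finsupp.mem_supported _ _).1 h hs)

variable [Algebra ℂ K] (P : Params K)

/-- Constants shorten the word. Moving z past w at e₁ removes a passage through e₀; the rules for
w₃z³ at e₀ or e₁ and for z³w₃ at e₂ remove letters of index 3; exchanging two z's or two w's moves
the smaller index to the right, which lowers the disorder. -/
theorem rule2_mem_below {a b c : Node} (x : Arrow a b) (y : Arrow b c) {f : Lin K a c}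
    (h : rule2 P x y = some f) : f ∈ below K (path2 x y) := by
  cases x <;> cases y <;> rename_i i j <;> fin_cases i <;> fin_cases j <;>
    simp only [rule2, ruleZZ, ruleWW, ruleZW11, ruleWZ11, ruleWZ00, ruleZW22, Fin.mk_zero,
      Fin.mk_one, Fin.reduceFinMk, Option.some.injEq, reduceCtorEq] at h <;>
    subst h <;>
    repeat' first
      | apply Submodule.add_mem
      | apply Submodule.sub_mem
      | apply Submodule.neg_mem
      | (apply single_mem_below; decide)

theorem rule3_mem_below {a b c d : Node} (x : Arrow a b) (y : Arrow b c) (u : Arrow c d)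
    {f : Lin K a d} (h : rule3 P x y u = some f) : f ∈ below K (path3 x y u) := by
  cases x <;> cases y <;> cases u <;> simp only [rule3, reduceCtorEq] at h <;>
    rename_i i j k <;> fin_cases i <;> fin_cases j <;> fin_cases k <;>
    simp only [ruleZWZ, ruleWZW, ruleWWZ, Fin.mk_zero,
      Fin.mk_one, Fin.reduceFinMk, Option.some.injEq, reduceCtorEq] at h <;>
    subst h <;>
    repeat' first
      | apply Submodule.add_mem
      | apply Submodule.sub_mem
      | apply Submodule.neg_mem
      | (apply single_mem_below; decide)

end Termination

/-! ### The superfluous rules follow from the essential ones -/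

section Superfluous

variable {K : Type u} [CommRing K] [Algebra ℂ K] (P : Params K)

theorem Params.Q_mul_Qi : P.Q * P.Qi = 1 := by
  simp [Params.Q, Params.Qi]

/-- The ideal of the essential rules. -/
noncomputable abbrev essIdeal (a b : Node) : Submodule K (Lin K a b) := relIdeal (essRel P) a b

/-- The class of a combination of paths modulo the essential rules. -/
noncomputable abbrev cls (a b : Node) : Lin K a b →ₗ[K] (Lin K a b ⧸ essIdeal P a b) := (essIdeal P a b).mkQ

theorem cls_eq_iff {a b : Node} (f g : Lin K a b) :
    cls P a b f = cls P a b g ↔ f - g ∈ essIdeal P a b :=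
  Submodule.Quotient.eq _

theorem rule2_mem_essIdeal {a b c : Node} (x : Arrow a b) (y : Arrow b c) {f : Lin K a c}
    (h : rule2 P x y = some f) : mon 1 (path2 x y) - f ∈ essIdeal P a c :=
  subset_relIdeal ⟨b, x, y, f, h, rfl⟩

theorem cls_path3_bot {a b c d : Node} (x : Arrow a b) (y : Arrow b c) (u : Arrow c d)
    {f : Lin K a c} (h : rule2 P x y = some f) :
    cls P a d (mon 1 (path3 x y u)) = cls P a d (concat (mon 1 u.hom.toPath) f) := by
  rw [cls_eq_iff]
  have := concat_mem_relIdeal_left (mon 1 u.hom.toPath) (rule2_mem_essIdeal P x y h)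
  rwa [concat_sub_right, concat_single, mul_one] at this

theorem cls_path3_top {a b c d : Node} (x : Arrow a b) (y : Arrow b c) (u : Arrow c d)
    {f : Lin K b d} (h : rule2 P y u = some f) :
    cls P a d (mon 1 (path3 x y u)) = cls P a d (concat f (mon 1 x.hom.toPath)) := by
  rw [cls_eq_iff]
  have := concat_mem_relIdeal_right (mon 1 x.hom.toPath) (rule2_mem_essIdeal P y u h)
  rwa [concat_sub_left, concat_single, mul_one] at this

/-- The class of a path modulo the essential rules. -/
noncomputable def pcls {a b : Node} (p : Path a b) : Lin K a b ⧸ essIdeal P a b :=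
  cls P a b (Finsupp.single p 1)

theorem cls_single {a b : Node} (c : K) (p : Path a b) :
    cls P a b (Finsupp.single p c) = c • pcls P p := by
  rw [pcls, ← map_smul]; simp

/-- The word z^i z^k w_j from e₁ to e₂ through e₀ contains two overlapping tips. Reducing z^k w_j
gives the left side; exchanging the two z's and then reducing z^i w_j gives the right side. -/
theorem cls_zwz_swap (i j k : Fin 3) {c : K} {f g : Lin K e1 e1}
    (hf : ruleZW11 P k j = some f) (hc : ruleZZ P i k = some (mon c (zz k i)))
    (hg : ruleZW11 P i j = some g) :
    cls P _ _ (concat (mon 1 (z21 i)) f) = c • cls P _ _ (concat (mon 1 (z21 k)) g) := by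
  have hA := cls_path3_bot P (.w10 j) (.z01 k) (.z12 i) hf
  have hB := cls_path3_top P (.w10 j) (.z01 k) (.z12 i) hc
  have hC := cls_path3_bot P (.w10 j) (.z01 i) (.z12 k) hg
  rw [concat_single, mul_one, cls_single P c] at hB
  exact hA.symm.trans (hB.trans (congrArg (c • ·) hC))

/-- The mirror image of the previous lemma, for the overlapping tips of z^j w_i w_k. -/
theorem cls_wzw_swap (i j k : Fin 3) {c : K} {f g : Lin K e1 e1}
    (hf : ruleZW11 P j i = some f) (hc : ruleWW P i k = some (mon c (ww k i)))
    (hg : ruleZW11 P j k = some g) :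
    cls P _ _ (concat f (mon 1 (w12 k))) = c • cls P _ _ (concat g (mon 1 (w12 i))) := by
  have hA := cls_path3_top P (.w21 k) (.w10 i) (.z01 j) hf
  have hB := cls_path3_bot P (.w21 k) (.w10 i) (.z01 j) hc
  have hC := cls_path3_top P (.w21 i) (.w10 k) (.z01 j) hg
  rw [concat_single, one_mul, cls_single P c] at hB
  exact hA.symm.trans (hB.trans (congrArg (c • ·) hC))

theorem comp_wz11_z21 (i j k : Fin 3) : (wz11 j k).comp (z21 i) = zwz i j k := rfl
theorem comp_w12_wz11 (i j k : Fin 3) : (w12 k).comp (wz11 i j) = wzw i j k := rfl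
theorem comp_wz11_w01 (i j k : Fin 3) : (wz11 j k).comp (w01 i) = wwz i j k := rfl
theorem comp_idp {a b : Node} (p : Path a b) : p.comp (idp b) = p := rfl
theorem idp_comp {a b : Node} (p : Path a b) : (idp a).comp p = p := Path.nil_comp p

theorem cls_ruleZWZ (i j k : Fin 3) {f : Lin K e1 e2} (h : ruleZWZ P i j k = some f) :
    cls P _ _ (mon 1 (zwz i j k)) = cls P _ _ f := by
  have hQ := P.Q_mul_Qi
  have key := fun c f g => @cls_zwz_swap K _ _ P i j k c f g
  fin_cases i <;> fin_cases j <;> fin_cases k <;>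
    simp only [ruleZWZ, Fin.zero_eta, Fin.mk_one, Fin.reduceFinMk, Option.some.injEq,
      reduceCtorEq] at h <;> subst h <;> replace key := key _ _ _ rfl rfl rfl <;>
    simp only [Fin.zero_eta, Fin.mk_one, Fin.reduceFinMk, concat_sub_right,
      concat_single, comp_wz11_z21, idp_comp, map_add, map_sub, one_mul, cls_single] at key ⊢ <;>
    -- The coefficient of z^i w_j z^k in the exchange identity is 1, q⁻¹ or q; the three attempts
    -- multiply by its inverse.
    first
      | (linear_combination (norm := (match_scalars <;> grind)) key)
      | (linear_combination (norm := (match_scalars <;> grind)) P.Q • key)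
      | (linear_combination (norm := (match_scalars <;> grind)) P.Qi • key)

theorem cls_ruleWZW (i j k : Fin 3) {f : Lin K e2 e1} (h : ruleWZW P i j k = some f) :
    cls P _ _ (mon 1 (wzw i j k)) = cls P _ _ f := by
  have hQ := P.Q_mul_Qi
  have key := fun c f g => @cls_wzw_swap K _ _ P i j k c f g
  fin_cases i <;> fin_cases j <;> fin_cases k <;>
    simp only [ruleWZW, Fin.zero_eta, Fin.mk_one, Fin.reduceFinMk, Option.some.injEq,
      reduceCtorEq] at h <;> subst h <;> replace key := key _ _ _ rfl rfl rfl <;>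
    simp only [Fin.zero_eta, Fin.mk_one, Fin.reduceFinMk, concat_sub_left,
      concat_single, comp_w12_wz11, comp_idp, map_add, map_sub, mul_one, cls_single] at key ⊢ <;>
    first
      | (linear_combination (norm := (match_scalars <;> grind)) key)
      | (linear_combination (norm := (match_scalars <;> grind)) P.Q • key)
      | (linear_combination (norm := (match_scalars <;> grind)) P.Qi • key)

/-- These rules come from the overlap w_j w₃ z³: either exchange w_j and w₃, or replace w₃z³. -/
theorem cls_ruleWWZ (i j k : Fin 3) {f : Lin K e1 e0} (h : ruleWWZ P i j k = some f) :
    cls P _ _ (mon 1 (wwz i j k)) = cls P _ _ f := by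
  have hQ := P.Q_mul_Qi
  have key : ∀ {c : K}, ruleWW P j 2 = some (mon c (ww 2 j)) →
      c • pcls P (wwz 2 j 2) = -pcls P (wwz j 0 0) - pcls P (wwz j 1 1)
        + P.ts (3 / 2) • pcls P (w01 j) := by
    intro c hc
    have hA := cls_path3_top P (.z12 2) (.w21 2) (.w10 j) hc
    have hB := cls_path3_bot P (.z12 2) (.w21 2) (.w10 j) (f := _) rfl
    have hw : (Arrow.w10 j).hom.toPath = w01 j := rfl
    have hz : (Arrow.z12 2).hom.toPath.comp (ww 2 j) = wwz 2 j 2 := rfl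
    rw [hA] at hB
    simpa only [concat_single, concat_add_right, concat_sub_right, concat_neg_right, hw, hz,
      comp_wz11_w01, idp_comp, map_add, map_sub, map_neg, mul_one, one_mul, cls_single,
      one_smul] using hB
  -- For j = 1 the overlap yields w₁w₂z², which still contains a tip; the rule is stated with
  -- w₂w₁z².
  have hswap : pcls P (wwz 0 1 1) = P.Qi • pcls P (wwz 1 0 1) := by
    have hA := cls_path3_top P (.z12 1) (.w21 1) (.w10 0) (f := _) rfl
    have hz : (Arrow.z12 1).hom.toPath.comp (ww 1 0) = wwz 1 0 1 := rfl
    rw [concat_single, mul_one, cls_single P P.Qi, hz] at hA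
    exact hA
  fin_cases i <;> fin_cases j <;> fin_cases k <;>
    simp only [ruleWWZ, Fin.zero_eta, Fin.mk_one, Fin.reduceFinMk, Option.some.injEq,
      reduceCtorEq] at h <;> subst h <;> replace key := key rfl <;>
    simp only [Fin.zero_eta, Fin.mk_one, Fin.reduceFinMk, map_sub, cls_single] at key ⊢
  · linear_combination (norm := (match_scalars <;> grind)) P.Qi • key - P.Qi • hswap
  · linear_combination (norm := (match_scalars <;> grind)) P.Q • key

theorem rule3_mem_essIdeal {a b c d : Node} (x : Arrow a b) (y : Arrow b c) (u : Arrow c d)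
    {f : Lin K a d} (h : rule3 P x y u = some f) : mon 1 (path3 x y u) - f ∈ essIdeal P a d := by
  rw [← cls_eq_iff]
  cases x <;> cases y <;> cases u <;> simp only [rule3, reduceCtorEq] at h
  · exact cls_ruleZWZ P _ _ _ h
  · exact cls_ruleWWZ P _ _ _ h
  · exact cls_ruleWZW P _ _ _ h

theorem supRel_subset_essIdeal (a b : Node) :
    supRel P a b ⊆ (essIdeal P a b : Set (Lin K a b)) := by
  rintro _ ⟨c, d, x, y, u, f, h, rfl⟩
  exact rule3_mem_essIdeal P x y u h

end Superfluous

/-! ### Right reduction terminates and preserves classes -/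

section Reduction

variable {K : Type u} [CommRing K] [Algebra ℂ K] (P : Params K)

/-- `f` is obtained from `p` by a reduction: it is smaller and in the same class. -/
def ReducesTo {a b : Node} (p : Path a b) (f : Lin K a b) : Prop :=
  f ∈ below K p ∧ mon 1 p - f ∈ essIdeal P a b

variable {P}

theorem ReducesTo.cons {a b c : Node} {p : Path a b} {f : Lin K a b} (h : ReducesTo P p f)
    (x : b ⟶ c) : ReducesTo P (p.cons x) (f.mapDomain fun r => r.cons x) := by
  refine ⟨below_cons h.1 x, ?_⟩
  have := concat_mem_relIdeal_left (mon 1 x.toPath) h.2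
  rwa [concat_sub_right, concat_single, mul_one, ← mapDomain_cons_eq_concat] at this

theorem ReducesTo.comp_left {a b c : Node} {p : Path b c} {f : Lin K b c} (h : ReducesTo P p f)
    (q : Path a b) : ReducesTo P (q.comp p) (f.mapDomain fun r => q.comp r) := by
  refine ⟨below_comp h.1 q, ?_⟩
  have := concat_mem_relIdeal_right (mon 1 q) h.2
  rwa [concat_sub_left, concat_single, mul_one, ← mapDomain_comp_eq_concat] at this

theorem reducesTo_of_rule2 {a b c : Node} (x : Arrow a b) (y : Arrow b c) {f : Lin K a c}
    (h : rule2 P x y = some f) : ReducesTo P (path2 x y) f :=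
  ⟨rule2_mem_below P x y h, rule2_mem_essIdeal P x y h⟩

theorem reducesTo_of_rule3 {a b c d : Node} (x : Arrow a b) (y : Arrow b c) (u : Arrow c d)
    {f : Lin K a d} (h : rule3 P x y u = some f) : ReducesTo P (path3 x y u) f :=
  ⟨rule3_mem_below P x y u h, rule3_mem_essIdeal P x y u h⟩

theorem reducesTo_of_topRule {a b : Node} (p : Path a b) {f : Lin K a b}
    (h : topRule P p = some f) : ReducesTo P p f := by
  rcases p with _ | ⟨_ | ⟨_ | ⟨p, x⟩, y⟩, u⟩
  · simp [topRule] at h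
  · simp [topRule] at h
  · rw [topRule] at h
    exact reducesTo_of_rule2 _ _ h
  · rw [topRule] at h
    split at h
    · rename_i g hg
      cases h
      exact (reducesTo_of_rule2 _ _ hg).comp_left _
    · obtain ⟨g, hg, rfl⟩ := Option.map_eq_some_iff.1 h
      exact (reducesTo_of_rule3 _ _ _ hg).comp_left _

theorem reducesTo_of_rightStep {a b : Node} (p : Path a b) {f : Lin K a b}
    (h : rightStep P p = some f) : ReducesTo P p f := by
  induction p with
  | nil => simp [rightStep] at h
  | cons p x ih =>
    rw [rightStep] at h
    split at h
    · rename_i g hg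
      cases h
      exact (ih hg).cons x
    · exact reducesTo_of_topRule _ h

variable (P)

theorem redStep_single_of_some {a b : Node} {p : Path a b} {f : Lin K a b}
    (h : rightStep P p = some f) (c : K) : redStep P a b (Finsupp.single p c) = c • f := by
  simp [redStep, h]

theorem redStep_of_mem_irr {a b : Node} {f : Lin K a b} (hf : f ∈ irr P a b) :
    redStep P a b f = f := by
  rw [redStep, Finsupp.linearCombination_apply]
  conv_rhs => rw [← Finsupp.sum_single f]
  refine Finsupp.sum_congr fun p hp => ?_
  have : rightStep P p = none := hf hp
  simp [this]

theorem redStep_iterate_of_mem_irr {a b : Node} {f : Lin K a b} (hf : f ∈ irr P a b) (n : ℕ) :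
    (redStep P a b)^[n] f = f :=
  Function.iterate_fixed (redStep_of_mem_irr P hf) n

theorem sub_redStep_mem {a b : Node} (f : Lin K a b) : f - redStep P a b f ∈ essIdeal P a b := by
  induction f using Finsupp.induction_linear with
  | zero => simp
  | add f g hf hg => rw [map_add, add_sub_add_comm]; exact add_mem hf hg
  | single p c =>
    cases h : rightStep P p with
    | none =>
      rw [redStep_of_mem_irr P (Finsupp.single_mem_supported K c h), sub_self]
      exact zero_mem _
    | some f =>
      rw [redStep_single_of_some P h]
      have := Submodule.smul_mem _ c (reducesTo_of_rightStep p h).2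
      rwa [smul_sub, Finsupp.smul_single, smul_eq_mul, mul_one] at this

theorem sub_redStep_iterate_mem {a b : Node} (f : Lin K a b) (n : ℕ) :
    f - (redStep P a b)^[n] f ∈ essIdeal P a b := by
  induction n with
  | zero => simp
  | succ n ih =>
    rw [Function.iterate_succ_apply', ← sub_add_sub_cancel]
    exact add_mem ih (sub_redStep_mem P _)

/-- Combinations of paths on which right reduction terminates. -/
noncomputable def terminating (a b : Node) : Submodule K (Lin K a b) where
  carrier := {f | ∃ n : ℕ, (redStep P a b)^[n] f ∈ irr P a b}
  zero_mem' := ⟨0, zero_mem _⟩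
  add_mem' := by
    rintro f g ⟨m, hm⟩ ⟨n, hn⟩
    -- Irreducible combinations are fixed by a reduction step, so extra steps do no harm and one
    -- exponent serves both summands.
    refine ⟨m + n, ?_⟩
    have h1 : (redStep P a b)^[m + n] f = (redStep P a b)^[m] f := by
      rw [add_comm, Function.iterate_add_apply, redStep_iterate_of_mem_irr P hm]
    have h2 : (redStep P a b)^[m + n] g = (redStep P a b)^[n] g := by
      rw [Function.iterate_add_apply, redStep_iterate_of_mem_irr P hn]
    rw [iterate_map_add, h1, h2]
    exact add_mem hm hn
  smul_mem' := by
    rintro c f ⟨m, hm⟩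
    refine ⟨m, ?_⟩
    rw [← Module.End.pow_apply] at hm ⊢
    rw [map_smul]
    exact Submodule.smul_mem _ c hm

/-- Well-founded induction along `Less`: one step turns a reducible path into a combination of
smaller ones, and terminating combinations form a submodule. -/
theorem single_mem_terminating {a b : Node} (p : Path a b) (c : K) :
    Finsupp.single p c ∈ terminating P a b := by
  induction p using (wellFounded_less a b).induction generalizing c with
  | _ p ih =>
    cases h : rightStep P p with
    | none => exact ⟨0, Finsupp.single_mem_supported K c h⟩
    | some f =>
      have hle : below K p ≤ terminating P a b := by
        intro g hg
        rw [← Finsupp.sum_single g]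
        exact Submodule.sum_mem _ fun r hr => ih r (hg hr) _
      obtain ⟨n, hn⟩ := Submodule.smul_mem _ c (hle (reducesTo_of_rightStep p h).1)
      exact ⟨n + 1, by rwa [Function.iterate_succ_apply, redStep_single_of_some P h]⟩

theorem redStep_terminates {a b : Node} (f : Lin K a b) :
    ∃ n : ℕ, (redStep P a b)^[n] f ∈ irr P a b := by
  have : f ∈ terminating P a b := by
    rw [← Finsupp.sum_single f]
    exact Submodule.sum_mem _ fun r _ => single_mem_terminating P r _
  exact this

theorem redR_mem_irr {a b : Node} (f : Lin K a b) : redR P f ∈ irr P a b := by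
  classical
  rw [redR, dif_pos (redStep_terminates P f)]
  exact Nat.find_spec (redStep_terminates P f)

theorem sub_redR_mem {a b : Node} (f : Lin K a b) : f - redR P f ∈ essIdeal P a b := by
  classical
  rw [redR, dif_pos (redStep_terminates P f)]
  exact sub_redStep_iterate_mem P f _

theorem redR_of_mem_irr {a b : Node} {f : Lin K a b} (hf : f ∈ irr P a b) : redR P f = f := by
  classical
  rw [redR, dif_pos (redStep_terminates P f)]
  exact redStep_iterate_of_mem_irr P hf _

end Reduction

/-! ### Normal form of irreducible paths and their leading monomials -/

section Irreducible

/-- The index of a letter `z`. -/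
def Arrow.zIdx : ∀ {a b : Node}, Arrow a b → List (Fin 3)
  | _, _, .z01 i => [i]
  | _, _, .z12 i => [i]
  | _, _, .w10 _ => []
  | _, _, .w21 _ => []

/-- The index of a letter `w`. -/
def Arrow.wIdx : ∀ {a b : Node}, Arrow a b → List (Fin 3)
  | _, _, .z01 _ => []
  | _, _, .z12 _ => []
  | _, _, .w10 i => [i]
  | _, _, .w21 i => [i]

/-- The indices of the letters `z` of a word, from left to right. -/
def zs {a : Node} : ∀ {b : Node}, Path a b → List (Fin 3)
  | _, .nil => []
  | _, .cons p x => Arrow.zIdx x ++ zs p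

/-- The indices of the letters `w` of a word, from left to right. -/
def ws {a : Node} : ∀ {b : Node}, Path a b → List (Fin 3)
  | _, .nil => []
  | _, .cons p x => Arrow.wIdx x ++ ws p

/-- The endpoints fix the difference between the numbers of z's and w's. This supplies the equation
that leading monomials miss, since z³ becomes 1 on the chart. -/
theorem length_zs_sub_length_ws {a b : Node} (p : Path a b) :
    ((zs p).length : ℤ) - (ws p).length = b.pos - a.pos := by
  induction p with
  | nil => simp [zs, ws]
  | cons p x ih =>
    change Arrow _ _ at x
    cases x <;> simp only [zs, ws, Arrow.zIdx, Arrow.wIdx, List.length_append, List.length_cons,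
      List.length_nil, Node.pos] at ih ⊢ <;> push_cast <;> omega

variable {K : Type u} [CommRing K] [Algebra ℂ K] {P : Params K}

theorem rightStep_tail {a b c : Node} {p : Path a b} {x : b ⟶ c}
    (h : rightStep P (p.cons x) = none) : rightStep P p = none := by
  rw [rightStep] at h
  split at h
  · cases h
  · assumption

theorem topRule_eq_none {a b c : Node} {p : Path a b} {x : b ⟶ c}
    (h : rightStep P (p.cons x) = none) : topRule P (p.cons x) = none := by
  rw [rightStep] at h
  split at h
  · cases h
  · exact h

theorem rule2_eq_none {a b c d : Node} {p : Path a b} {x : Arrow b c} {y : Arrow c d}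
    (h : rightStep P ((p.cons x.hom).cons y.hom) = none) : rule2 P x y = none := by
  have h' := topRule_eq_none h
  rcases p with _ | ⟨p, w⟩
  · rwa [topRule] at h'
  · rw [topRule] at h'
    split at h'
    · cases h'
    · assumption

theorem rule3_eq_none {a b c d e : Node} {p : Path a b} {x : Arrow b c} {y : Arrow c d}
    {u : Arrow d e} (h : rightStep P (((p.cons x.hom).cons y.hom).cons u.hom) = none) :
    rule3 P x y u = none := by
  have h' := topRule_eq_none h
  rw [topRule] at h'
  split at h'
  · cases h'
  · exact Option.map_eq_none_iff.1 h'

/-- The letters `z` are sorted, the letters `w` are sorted, and `z³`, `w₃` do not both occur. -/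
def Sorted {a b : Node} (p : Path a b) : Prop :=
  (zs p).Pairwise (· ≥ ·) ∧ (ws p).Pairwise (· ≥ ·) ∧ ¬(2 ∈ zs p ∧ 2 ∈ ws p)

theorem ruleZZ_none {i j : Fin 3} (h : ruleZZ P i j = none) : j ≤ i := by
  fin_cases i <;> fin_cases j <;> first | decide | simp [ruleZZ] at h

theorem ruleWW_none {i j : Fin 3} (h : ruleWW P i j = none) : j ≤ i := by
  fin_cases i <;> fin_cases j <;> first | decide | simp [ruleWW] at h

theorem ruleZW11_ne_none {i j : Fin 3} : ruleZW11 P i j ≠ none := by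
  fin_cases i <;> fin_cases j <;> simp [ruleZW11]

/-- The out-of-order triples without a rule of their own all have j = k = 3 in the usual numbering,
so they contain the tip w₃z³. In the next lemma z³w₃ plays the same role. -/
theorem ruleZWZ_none {i j k : Fin 3} (h : ruleZWZ P i j k = none) (h' : ruleWZ11 P j k = none) :
    k ≤ i := by
  fin_cases i <;> fin_cases j <;> fin_cases k <;>
    first | decide | (simp [ruleZWZ] at h; done) | simp [ruleWZ11] at h'

theorem ruleWZW_none {i j k : Fin 3} (h : ruleWZW P i j k = none) (h' : ruleZW22 P j k = none) :
    k ≤ i := by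
  fin_cases i <;> fin_cases j <;> fin_cases k <;>
    first | decide | (simp [ruleWZW] at h; done) | simp [ruleZW22] at h'

theorem ruleWWZ_none {j : Fin 3} (h : ruleWWZ P 2 j 2 = none) (h' : ruleWZ11 P j 2 = none) :
    False := by
  fin_cases j <;> first | (simp [ruleWWZ] at h; done) | simp [ruleWZ11] at h'

theorem eq_two_of_mem {i : Fin 3} {l : List (Fin 3)} (h : (i :: l).Pairwise (· ≥ ·))
    (h2 : 2 ∈ i :: l) : i = 2 := by
  rcases List.mem_cons.1 h2 with h2 | h2
  · exact h2.symm
  · have := (List.pairwise_cons.1 h).1 2 h2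
    omega

theorem pairwise_cons_cons {i j : Fin 3} {l : List (Fin 3)} (h : (j :: l).Pairwise (· ≥ ·))
    (hij : j ≤ i) : (i :: j :: l).Pairwise (· ≥ ·) := by
  refine List.pairwise_cons.2 ⟨fun k hk => ?_, h⟩
  rcases List.mem_cons.1 hk with rfl | hk
  · exact hij
  · exact ((List.pairwise_cons.1 h).1 k hk).trans hij

/-- An irreducible path only passes through `e₀` at its ends. -/
theorem eq_nil_of_rightStep_cons_z01 {a : Node} {p : Path a e0} {i : Fin 3}
    (h : rightStep P (p.cons (Arrow.z01 i).hom) = none) : ∃ h : a = e0, p = h ▸ idp a := by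
  rcases p with _ | ⟨p, y⟩
  · exact ⟨rfl, rfl⟩
  · change Arrow _ _ at y
    cases y
    exact absurd (rule2_eq_none (x := Arrow.w10 _) h) ruleZW11_ne_none

/-- Away from its ends an irreducible path alternates between e₁ and e₂, so consecutive letters of
one kind are at most two places apart. Tips of length two and three therefore control both orders.
-/
theorem sorted_of_rightStep_eq_none {a b : Node} (p : Path a b) (h : rightStep P p = none) :
    Sorted p := by
  induction p with
  | nil => simp [Sorted, zs, ws]
  | cons p u ih =>
    have ih := ih (rightStep_tail h)
    change Arrow _ _ at u
    cases u with
    | z01 k =>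
      obtain ⟨rfl, rfl⟩ := eq_nil_of_rightStep_cons_z01 h
      simp [Sorted, zs, ws, idp, Arrow.zIdx, Arrow.wIdx]
    | z12 k =>
      rcases p with _ | ⟨p, y⟩
      · simp [Sorted, zs, ws, Arrow.zIdx, Arrow.wIdx]
      change Arrow _ _ at y
      cases y with
      | z01 j =>
        obtain ⟨rfl, rfl⟩ := eq_nil_of_rightStep_cons_z01 (rightStep_tail h)
        have := ruleZZ_none (rule2_eq_none (x := Arrow.z01 j) (y := Arrow.z12 k) h)
        simpa [Sorted, zs, ws, idp, Arrow.zIdx, Arrow.wIdx] using this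
      | w21 j =>
        have hkj := rule2_eq_none (x := Arrow.w21 j) (y := Arrow.z12 k) h
        have hz : (zs ((p.cons (Arrow.w21 j).hom).cons (Arrow.z12 k).hom)).Pairwise (· ≥ ·) := by
          rcases p with _ | ⟨p, x⟩
          · exact List.pairwise_singleton (· ≥ ·) k
          change Arrow _ _ at x
          cases x with
          | z12 i =>
            refine pairwise_cons_cons ih.1 (ruleZWZ_none (P := P) (j := j) ?_ ?_)
            · exact rule3_eq_none (x := Arrow.z12 i) (y := Arrow.w21 j) (u := Arrow.z12 k) h
            · exact rule2_eq_none (x := Arrow.z12 i) (y := Arrow.w21 j) (rightStep_tail h)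
        -- A descending list containing the largest index starts with it. If z³ and w₃ both
        -- occurred, they would be the leftmost letters of their kinds, here adjacent, and would
        -- form a tip.
        refine ⟨hz, ih.2.1, fun h2 => ?_⟩
        obtain rfl := eq_two_of_mem hz h2.1
        obtain rfl := eq_two_of_mem ih.2.1 h2.2
        simp [rule2, ruleZW22] at hkj
    | w21 k =>
      rcases p with _ | ⟨p, y⟩
      · simp [Sorted, zs, ws, Arrow.zIdx, Arrow.wIdx]
      change Arrow _ _ at y
      cases y with
      | z12 j =>
        have hkj := rule2_eq_none (x := Arrow.z12 j) (y := Arrow.w21 k) h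
        have hz : (ws ((p.cons (Arrow.z12 j).hom).cons (Arrow.w21 k).hom)).Pairwise (· ≥ ·) := by
          rcases p with _ | ⟨p, x⟩
          · exact List.pairwise_singleton (· ≥ ·) k
          change Arrow _ _ at x
          cases x with
          | z01 i =>
            obtain ⟨rfl, rfl⟩ := eq_nil_of_rightStep_cons_z01 (rightStep_tail (rightStep_tail h))
            exact List.pairwise_singleton (· ≥ ·) k
          | w21 i =>
            refine pairwise_cons_cons ih.2.1 (ruleWZW_none (P := P) (j := j) ?_ ?_)
            · exact rule3_eq_none (x := Arrow.w21 i) (y := Arrow.z12 j) (u := Arrow.w21 k) h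
            · exact rule2_eq_none (x := Arrow.w21 i) (y := Arrow.z12 j) (rightStep_tail h)
        refine ⟨ih.1, hz, fun h2 => ?_⟩
        obtain rfl := eq_two_of_mem hz h2.2
        obtain rfl := eq_two_of_mem ih.1 h2.1
        simp [rule2, ruleWZ11] at hkj
    | w10 k =>
      rcases p with _ | ⟨p, y⟩
      · simp [Sorted, zs, ws, Arrow.zIdx, Arrow.wIdx]
      change Arrow _ _ at y
      cases y with
      | z01 j =>
        obtain ⟨rfl, rfl⟩ := eq_nil_of_rightStep_cons_z01 (rightStep_tail h)
        have hkj := rule2_eq_none (x := Arrow.z01 j) (y := Arrow.w10 k) h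
        refine ⟨ih.1, by simp [ws, idp, Arrow.wIdx], fun h2 => ?_⟩
        simp only [zs, ws, idp, Arrow.zIdx, Arrow.wIdx, List.append_nil, List.nil_append,
          List.mem_singleton] at h2
        obtain ⟨rfl, rfl⟩ := h2
        simp [rule2, ruleWZ00] at hkj
      | w21 j =>
        have hkj := rule2_eq_none (x := Arrow.w21 j) (y := Arrow.w10 k) h
        have hz : (ws ((p.cons (Arrow.w21 j).hom).cons (Arrow.w10 k).hom)).Pairwise (· ≥ ·) :=
          pairwise_cons_cons ih.2.1 (ruleWW_none hkj)
        refine ⟨ih.1, hz, fun h2 => ?_⟩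
        obtain rfl := eq_two_of_mem hz h2.2
        rcases p with _ | ⟨p, x⟩
        · simp [zs, Arrow.zIdx] at h2
        change Arrow _ _ at x
        cases x with
        | z12 i =>
          obtain rfl := eq_two_of_mem (show (i :: zs p).Pairwise (· ≥ ·) from ih.1) h2.1
          -- Here the leftmost z and w are separated by one letter: the word begins w₃ w_j z³, which
          -- the superfluous rules at e₀ exclude.
          exact ruleWWZ_none (P := P) (j := j)
            (rule3_eq_none (x := Arrow.z12 2) (y := Arrow.w21 j) (u := Arrow.w10 2) h)
            (rule2_eq_none (x := Arrow.z12 2) (y := Arrow.w21 j) (rightStep_tail h))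

/-- An irreducible path is determined by its letters. -/
theorem eq_of_zs_eq_of_ws_eq {a b : Node} {p p' : Path a b} (h : rightStep P p = none)
    (h' : rightStep P p' = none) (hz : zs p = zs p') (hw : ws p = ws p') : p = p' := by
  induction p with
  | nil =>
    cases p' with
    | nil => rfl
    | cons p' x =>
      change Arrow _ _ at x
      cases x <;> simp [zs, ws, Arrow.zIdx, Arrow.wIdx] at hz hw
  | cons p x ih =>
    cases p' with
    | nil =>
      change Arrow _ _ at x
      cases x <;> simp [zs, ws, Arrow.zIdx, Arrow.wIdx] at hz hw
    | cons p' y =>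
      have ih := fun q => @ih q (rightStep_tail h)
      change Arrow _ _ at x
      change Arrow _ _ at y
      cases x with
      | z12 i =>
        cases y with
        | z12 j =>
          simp only [zs, ws, Arrow.zIdx, Arrow.wIdx, List.cons_append, List.nil_append,
            List.cons.injEq] at hz hw
          rw [ih p' (rightStep_tail h') hz.2 hw, hz.1]
      | w10 i =>
        cases y with
        | w10 j =>
          simp only [zs, ws, Arrow.zIdx, Arrow.wIdx, List.cons_append, List.nil_append,
            List.cons.injEq] at hz hw
          rw [ih p' (rightStep_tail h') hz hw.2, hw.1]
      | z01 i =>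
        cases y with
        | z01 j =>
          simp only [zs, ws, Arrow.zIdx, Arrow.wIdx, List.cons_append, List.nil_append,
            List.cons.injEq] at hz hw
          rw [ih p' (rightStep_tail h') hz.2 hw, hz.1]
        | w21 j =>
          obtain ⟨rfl, rfl⟩ := eq_nil_of_rightStep_cons_z01 h
          simp [ws, idp, Arrow.wIdx] at hw
      | w21 i =>
        cases y with
        | z01 j =>
          obtain ⟨rfl, rfl⟩ := eq_nil_of_rightStep_cons_z01 h'
          simp [ws, idp, Arrow.wIdx] at hw
        | w21 j =>
          simp only [zs, ws, Arrow.zIdx, Arrow.wIdx, List.cons_append, List.nil_append,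
            List.cons.injEq] at hz hw
          rw [ih p' (rightStep_tail h') hz hw.2, hw.1]

theorem length_eq_count (l : List (Fin 3)) :
    l.length = l.count 0 + l.count 1 + l.count 2 := by
  induction l with
  | nil => rfl
  | cons i l ih => fin_cases i <;> simp <;> omega

theorem eq_of_count_eq {l l' : List (Fin 3)} (h : l.Pairwise (· ≥ ·)) (h' : l'.Pairwise (· ≥ ·))
    (h0 : l.count 0 = l'.count 0) (h1 : l.count 1 = l'.count 1) (h2 : l.count 2 = l'.count 2) :
    l = l' := by
  have : l.Perm l' := List.perm_iff_count.2 fun i => by fin_cases i <;> assumption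
  exact this.eq_of_pairwise (fun a b _ _ h h' => le_antisymm h' h) h h'

/-- The leading monomial of the function given by a letter on the chart `z³ ≠ 0`. -/
noncomputable def Arrow.lead : ∀ {a b : Node}, Arrow a b → (Fin 2 ⊕ Fin 2 →₀ ℕ)
  | _, _, .z01 i => ![.single (.inl 0) 1, .single (.inl 1) 1, 0] i
  | _, _, .z12 i => ![.single (.inl 0) 1, .single (.inl 1) 1, 0] i
  | _, _, .w10 i => ![.single (.inr 0) 1, .single (.inr 1) 1,
      .single (.inl 0) 1 + .single (.inr 0) 1] i
  | _, _, .w21 i => ![.single (.inr 0) 1, .single (.inr 1) 1,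
      .single (.inl 0) 1 + .single (.inr 0) 1] i

/-- The leading monomial of the function given by a path on the chart `z³ ≠ 0`. -/
noncomputable def lead {a : Node} : ∀ {b : Node}, Path a b → (Fin 2 ⊕ Fin 2 →₀ ℕ)
  | _, .nil => 0
  | _, .cons p x => lead p + Arrow.lead x

theorem lead_apply {a b : Node} (p : Path a b) :
    lead p (.inl 0) = (zs p).count 0 + (ws p).count 2 ∧ lead p (.inl 1) = (zs p).count 1 ∧
    lead p (.inr 0) = (ws p).count 0 + (ws p).count 2 ∧ lead p (.inr 1) = (ws p).count 1 := by
  induction p with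
  | nil => simp [lead, zs, ws]
  | cons p x ih =>
    change Arrow _ _ at x
    obtain ⟨h1, h2, h3, h4⟩ := ih
    cases x <;> rename_i i <;> fin_cases i <;>
      simp [lead, zs, ws, Arrow.zIdx, Arrow.wIdx, Arrow.lead, h1, h2, h3, h4] <;> omega

/-- Irreducible paths have different leading monomials. -/
theorem eq_of_lead_eq {a b : Node} {p p' : Path a b} (h : rightStep P p = none)
    (h' : rightStep P p' = none) (hl : lead p = lead p') : p = p' := by
  obtain ⟨hz, hw, h2⟩ := sorted_of_rightStep_eq_none p h
  obtain ⟨hz', hw', h2'⟩ := sorted_of_rightStep_eq_none p' h'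
  have hp := length_zs_sub_length_ws p
  have hp' := length_zs_sub_length_ws p'
  rw [← hp', length_eq_count, length_eq_count, length_eq_count (zs p'),
    length_eq_count (ws p')] at hp
  obtain ⟨e1, e2, e3, e4⟩ := lead_apply p
  obtain ⟨e1', e2', e3', e4'⟩ := lead_apply p'
  rw [hl] at e1 e2 e3 e4
  rw [← List.count_pos_iff, ← List.count_pos_iff] at h2 h2'
  push_cast at hp
  -- Four exponents and the weight are five equations for six letter counts. They determine the
  -- number of z³ minus the number of w₃, and one of these two numbers is zero.
  refine eq_of_zs_eq_of_ws_eq h h' (eq_of_count_eq hz hz' ?_ ?_ ?_)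
    (eq_of_count_eq hw hw' ?_ ?_ ?_) <;> omega

end Irreducible

/-! ### Representation by twisted differential operators on the chart -/

section Representation

open MvPolynomial

/-- Polynomials in `x¹, x², ξ₁, ξ₂` with coefficients in `K`. -/
abbrev Fun (K : Type u) [CommRing K] : Type u := MvPolynomial (Fin 2 ⊕ Fin 2) K

variable {K : Type u} [CommRing K]

/-- The action of a torus element on functions on the chart. -/
noncomputable def scale (u : Fin 2 → Kˣ) : Fun K →ₐ[K] Fun K :=
  aeval (Sum.elim (fun i => C (u i : K) * X (.inl i)) fun i => C ((u i)⁻¹ : Kˣ).val * X (.inr i))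

@[simp] theorem scale_C (u : Fin 2 → Kˣ) (c : K) : scale u (C c) = C c := by
  simp [scale]

@[simp] theorem scale_X_inl (u : Fin 2 → Kˣ) (i : Fin 2) :
    scale u (X (.inl i)) = C (u i : K) * X (.inl i) := by simp [scale]

@[simp] theorem scale_X_inr (u : Fin 2 → Kˣ) (i : Fin 2) :
    scale u (X (.inr i)) = C ((u i)⁻¹ : Kˣ).val * X (.inr i) := by simp [scale]

theorem scale_scale (u v : Fin 2 → Kˣ) (F : Fun K) : scale u (scale v F) = scale (u * v) F := by
  have : (scale u).comp (scale v) = scale (u * v) := by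
    refine algHom_ext fun i => ?_
    rcases i with i | i <;> simp [mul_left_comm, mul_assoc]
  exact DFunLike.congr_fun this F

@[simp] theorem scale_one (F : Fun K) : scale 1 F = F := by
  have : scale (1 : Fin 2 → Kˣ) = AlgHom.id K _ := by
    refine algHom_ext fun i => ?_
    rcases i with i | i <;> simp
  exact DFunLike.congr_fun this F

/-- The chain rule for a dilation. It lets the twists be moved past the derivatives in ξ_i + s
∂_{x^i}. -/
theorem pderiv_scale (u : Fin 2 → Kˣ) (i : Fin 2) (F : Fun K) :
    pderiv (.inl i) (scale u F) = C (u i : K) * scale u (pderiv (.inl i) F) := by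
  induction F using MvPolynomial.induction_on with
  | C c => simp
  | add F G hF hG => simp only [map_add, hF, hG, mul_add]
  | mul_X F j hF =>
    rcases j with j | j
    · by_cases h : j = i
      · subst h
        simp only [map_mul, Derivation.leibniz, hF, smul_eq_mul, scale_X_inl, pderiv_C,
          pderiv_X_self, map_add, map_one]
        ring
      · have : (Sum.inl j : Fin 2 ⊕ Fin 2) ≠ Sum.inl i := fun e => h (Sum.inl.inj e)
        simp only [map_mul, Derivation.leibniz, hF, smul_eq_mul, scale_X_inl, pderiv_C,
          pderiv_X_of_ne this, map_add, map_zero]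
        ring
    · have : (Sum.inr j : Fin 2 ⊕ Fin 2) ≠ Sum.inl i := Sum.inr_ne_inl
      simp only [map_mul, Derivation.leibniz, hF, smul_eq_mul, scale_X_inr, pderiv_C,
          pderiv_X_of_ne this, map_add, map_zero]
      ring

/-- The deformation `ξ_i + s ∂_{x^i}` of `ξ_i`. -/
noncomputable def momentum (s : K) (i : Fin 2) : Fun K →ₗ[K] Fun K :=
  LinearMap.mulLeft K (X (.inr i)) + s • (pderiv (.inl i)).toLinearMap

theorem momentum_apply (s : K) (i : Fin 2) (F : Fun K) :
    momentum s i F = X (.inr i) * F + C s * pderiv (.inl i) F := by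
  simp [momentum, MvPolynomial.smul_eq_C_mul]

variable [Algebra ℂ K] (P : Params K)

/-- The twist of `z¹`. -/
noncomputable def twA : Fun K →ₐ[K] Fun K := scale ![P.q⁻¹, (P.q ^ 2)⁻¹]
/-- The twist of `w₁`. -/
noncomputable def twA' : Fun K →ₐ[K] Fun K := scale ![P.q, P.q ^ 2]
/-- The twist of `z²`. -/
noncomputable def twB : Fun K →ₐ[K] Fun K := scale ![P.q, P.q]
/-- The twist of `w₂`. -/
noncomputable def twB' : Fun K →ₐ[K] Fun K := scale ![P.q⁻¹, P.q⁻¹]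

/-- The operator of `z^i` on sections of `O(d)`. -/
noncomputable def opZ (d : ℕ) : Fin 3 → (Fun K →ₗ[K] Fun K)
  | 0 => LinearMap.mulLeft K (C (P.Q ^ d) * X (.inl 0)) ∘ₗ (twA P).toLinearMap
  | 1 => LinearMap.mulLeft K (C (P.Qi ^ d) * X (.inl 1)) ∘ₗ (twB P).toLinearMap
  | 2 => LinearMap.id

/-- The operator of `w_i` on sections of `O(d)`, where `∑ z^i w_i = κ`. -/
noncomputable def opW (d : ℕ) (κ : K) : Fin 3 → (Fun K →ₗ[K] Fun K)
  | 0 => LinearMap.mulLeft K (C (P.Qi ^ d)) ∘ₗ momentum P.s 0 ∘ₗ (twA' P).toLinearMap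
  | 1 => LinearMap.mulLeft K (C (P.Q ^ d)) ∘ₗ momentum P.s 1 ∘ₗ (twB' P).toLinearMap
  | 2 => LinearMap.mulLeft K (C κ) - LinearMap.mulLeft K (X (.inl 0)) ∘ₗ momentum P.s 0
      - LinearMap.mulLeft K (X (.inl 1)) ∘ₗ momentum P.s 1

/-- The operator of an arrow. -/
noncomputable def op : ∀ {a b : Node}, Arrow a b → (Fun K →ₗ[K] Fun K)
  | _, _, .z01 i => opZ P 0 i
  | _, _, .z12 i => opZ P 1 i
  | _, _, .w10 i => opW P 1 (P.ts (-(3 / 2))) i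
  | _, _, .w21 i => opW P 2 (P.ts (-(1 / 2))) i

/-- The operator of a path. -/
noncomputable def opPath {a : Node} : ∀ {b : Node}, Path a b → (Fun K →ₗ[K] Fun K)
  | _, .nil => LinearMap.id
  | _, .cons p x => op P x ∘ₗ opPath p

/-- The operator of a linear combination of paths. -/
noncomputable def opLin (a b : Node) : Lin K a b →ₗ[K] (Fun K →ₗ[K] Fun K) :=
  Finsupp.linearCombination K fun p => opPath P p

theorem opLin_single {a b : Node} (p : Path a b) (c : K) :
    opLin P a b (Finsupp.single p c) = c • opPath P p := by
  simp [opLin]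

theorem opPath_comp {a b c : Node} (p : Path a b) (r : Path b c) :
    opPath P (p.comp r) = opPath P r ∘ₗ opPath P p := by
  induction r with
  | nil => rfl
  | cons r x ih => rw [Path.comp_cons, opPath, opPath, ih, LinearMap.comp_assoc]

theorem opLin_concat {a b c : Node} (u : Lin K b c) (v : Lin K a b) :
    opLin P a c (concat u v) = opLin P b c u ∘ₗ opLin P a b v := by
  induction u using Finsupp.induction_linear with
  | zero => simp [concat_zero_left]
  | add u u' h h' => rw [concat_add_left, map_add, h, h', map_add, LinearMap.add_comp]
  | single r y =>
    induction v using Finsupp.induction_linear with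
    | zero => simp [concat_zero_right]
    | add u u' h h' => rw [concat_add_right, map_add, h, h', map_add, LinearMap.comp_add]
    | single p x =>
      rw [concat_single, opLin_single, opLin_single, opLin_single, opPath_comp,
        LinearMap.smul_comp, LinearMap.comp_smul, smul_smul]

theorem opZ_zero_apply (d : ℕ) (F : Fun K) :
    opZ P d 0 F = C P.Q ^ d * X (.inl 0) * twA P F := by simp [opZ, mul_assoc]
theorem opZ_one_apply (d : ℕ) (F : Fun K) :
    opZ P d 1 F = C P.Qi ^ d * X (.inl 1) * twB P F := by simp [opZ, mul_assoc]
theorem opZ_two_apply (d : ℕ) (F : Fun K) : opZ P d 2 F = F := rfl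
theorem opW_zero_apply (d : ℕ) (κ : K) (F : Fun K) : opW P d κ 0 F =
    C P.Qi ^ d * (X (.inr 0) * twA' P F + C P.s * pderiv (.inl 0) (twA' P F)) := by
  simp [opW, momentum_apply]
theorem opW_one_apply (d : ℕ) (κ : K) (F : Fun K) : opW P d κ 1 F =
    C P.Q ^ d * (X (.inr 1) * twB' P F + C P.s * pderiv (.inl 1) (twB' P F)) := by
  simp [opW, momentum_apply]
theorem opW_two_apply (d : ℕ) (κ : K) (F : Fun K) : opW P d κ 2 F =
    C κ * F - X (.inl 0) * (X (.inr 0) * F + C P.s * pderiv (.inl 0) F)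
      - X (.inl 1) * (X (.inr 1) * F + C P.s * pderiv (.inl 1) F) := by
  simp [opW, momentum_apply]

theorem Params.val_inv_sq : ((P.q ^ 2)⁻¹ : Kˣ).val = P.Qi ^ 2 := by
  rw [← inv_pow, Units.val_pow_eq_pow_val, Params.Qi]

section Twist

variable (F : Fun K)

theorem twA_C (c : K) : twA P (C c) = C c := scale_C _ _
theorem twA_x0 : twA P (X (.inl 0)) = C P.Qi * X (.inl 0) := by simp [twA, Params.Qi]
theorem twA_x1 : twA P (X (.inl 1)) = C P.Qi ^ 2 * X (.inl 1) := by
  rw [twA, scale_X_inl, ← C_pow, ← P.val_inv_sq]; rfl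
theorem twA_y0 : twA P (X (.inr 0)) = C P.Q * X (.inr 0) := by simp [twA, Params.Q]
theorem twA_y1 : twA P (X (.inr 1)) = C P.Q ^ 2 * X (.inr 1) := by simp [twA, Params.Q]
theorem pderiv0_twA : pderiv (.inl 0) (twA P F) = C P.Qi * twA P (pderiv (.inl 0) F) := by
  simp [twA, pderiv_scale, Params.Qi]
theorem pderiv1_twA : pderiv (.inl 1) (twA P F) = C P.Qi ^ 2 * twA P (pderiv (.inl 1) F) := by
  rw [twA, pderiv_scale, ← C_pow, ← P.val_inv_sq]; rfl

theorem twA'_C (c : K) : twA' P (C c) = C c := scale_C _ _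
theorem twA'_x0 : twA' P (X (.inl 0)) = C P.Q * X (.inl 0) := by simp [twA', Params.Q]
theorem twA'_x1 : twA' P (X (.inl 1)) = C P.Q ^ 2 * X (.inl 1) := by simp [twA', Params.Q]
theorem twA'_y0 : twA' P (X (.inr 0)) = C P.Qi * X (.inr 0) := by simp [twA', Params.Qi]
theorem twA'_y1 : twA' P (X (.inr 1)) = C P.Qi ^ 2 * X (.inr 1) := by
  rw [twA', scale_X_inr, ← C_pow, ← P.val_inv_sq]; rfl
theorem pderiv0_twA' : pderiv (.inl 0) (twA' P F) = C P.Q * twA' P (pderiv (.inl 0) F) := by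
  simp [twA', pderiv_scale, Params.Q]
theorem pderiv1_twA' : pderiv (.inl 1) (twA' P F) = C P.Q ^ 2 * twA' P (pderiv (.inl 1) F) := by
  simp [twA', pderiv_scale, Params.Q]

theorem twB_C (c : K) : twB P (C c) = C c := scale_C _ _
theorem twB_x (i : Fin 2) : twB P (X (.inl i)) = C P.Q * X (.inl i) := by
  fin_cases i <;> simp [twB, Params.Q]
theorem twB_y (i : Fin 2) : twB P (X (.inr i)) = C P.Qi * X (.inr i) := by
  fin_cases i <;> simp [twB, Params.Qi]
theorem pderiv_twB (i : Fin 2) :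
    pderiv (.inl i) (twB P F) = C P.Q * twB P (pderiv (.inl i) F) := by
  fin_cases i <;> simp [twB, pderiv_scale, Params.Q]

theorem twB'_C (c : K) : twB' P (C c) = C c := scale_C _ _
theorem twB'_x (i : Fin 2) : twB' P (X (.inl i)) = C P.Qi * X (.inl i) := by
  fin_cases i <;> simp [twB', Params.Qi]
theorem twB'_y (i : Fin 2) : twB' P (X (.inr i)) = C P.Q * X (.inr i) := by
  fin_cases i <;> simp [twB', Params.Q]
theorem pderiv_twB' (i : Fin 2) :
    pderiv (.inl i) (twB' P F) = C P.Qi * twB' P (pderiv (.inl i) F) := by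
  fin_cases i <;> simp [twB', pderiv_scale, Params.Qi]

theorem twA_twA' : twA P (twA' P F) = F := by
  rw [twA, twA', scale_scale]
  convert scale_one F using 2
  ext i; fin_cases i <;> simp
theorem twA'_twA : twA' P (twA P F) = F := by
  rw [twA, twA', scale_scale, mul_comm, ← scale_scale]; exact twA_twA' P F
theorem twB_twB' : twB P (twB' P F) = F := by
  rw [twB, twB', scale_scale]
  convert scale_one F using 2
  ext i; fin_cases i <;> simp
theorem twB'_twB : twB' P (twB P F) = F := by
  rw [twB, twB', scale_scale, mul_comm, ← scale_scale]; exact twB_twB' P F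
theorem twB_twA : twB P (twA P F) = twA P (twB P F) := by
  rw [twB, twA, scale_scale, scale_scale, mul_comm]
theorem twB_twA' : twB P (twA' P F) = twA' P (twB P F) := by
  rw [twB, twA', scale_scale, scale_scale, mul_comm]
theorem twB'_twA : twB' P (twA P F) = twA P (twB' P F) := by
  rw [twB', twA, scale_scale, scale_scale, mul_comm]
theorem twB'_twA' : twB' P (twA' P F) = twA' P (twB' P F) := by
  rw [twB', twA', scale_scale, scale_scale, mul_comm]

end Twist

theorem pderiv_x0_x1 : pderiv (.inl 0) (X (.inl 1) : Fun K) = 0 := pderiv_X_of_ne (by decide)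
theorem pderiv_x1_x0 : pderiv (.inl 1) (X (.inl 0) : Fun K) = 0 := pderiv_X_of_ne (by decide)
theorem pderiv_x_y (i j : Fin 2) : pderiv (.inl i) (X (.inr j) : Fun K) = 0 :=
  pderiv_X_of_ne Sum.inr_ne_inl

/-- The commutator of two derivations is a derivation, and this one kills the variables. -/
theorem pderiv_comm (i j : Fin 2 ⊕ Fin 2) (F : Fun K) :
    pderiv i (pderiv j F) = pderiv j (pderiv i F) := by
  have : ⁅pderiv (R := K) i, pderiv j⁆ = 0 := derivation_ext fun k => by
    rw [Derivation.commutator_apply, pderiv_X, pderiv_X]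
    simp [Pi.single_apply, apply_ite]
  have h := DFunLike.congr_fun this F
  rwa [Derivation.commutator_apply, Derivation.zero_apply, sub_eq_zero] at h

theorem Params.ts_eq : P.ts (1 / 2) = P.t + algebraMap ℂ K (1 / 2) * P.s ∧
    P.ts (3 / 2) = P.t + P.s + algebraMap ℂ K (1 / 2) * P.s ∧
    P.ts (-(1 / 2)) = P.t - algebraMap ℂ K (1 / 2) * P.s ∧
    P.ts (-(3 / 2)) = P.t - P.s - algebraMap ℂ K (1 / 2) * P.s := by
  have : (3 / 2 : ℂ) = 1 + 1 / 2 := by norm_num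
  simp only [Params.ts, this, map_neg, map_add, map_one]
  refine ⟨trivial, ?_, ?_, ?_⟩ <;> ring

theorem opPath_path2 {a b c : Node} (x : Arrow a b) (y : Arrow b c) :
    opPath P (path2 x y) = op P y ∘ₗ op P x := rfl

/-- The twist exponents and the prefactors q^{±d}, with d the position of the source node, are tuned
to the powers of q in the rules. The identity [ξ_i + s∂_i, x^i] = s gives the shifts at e₁. The
constants κ = t − 3s/2 and t − s/2 are the values of ∑ z^i w_i that the rules force at e₁ and e₂. -/
theorem opLin_rule2 {a b c : Node} (x : Arrow a b) (y : Arrow b c) {f : Lin K a c}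
    (h : rule2 P x y = some f) : opLin P a c f = op P y ∘ₗ op P x := by
  have hQ : (C P.Q * C P.Qi : Fun K) = 1 := by rw [← C_mul, P.Q_mul_Qi, C_1]
  have hH : (2 * C (algebraMap ℂ K (1 / 2)) : Fun K) = 1 := by
    have : (2 : Fun K) = C (algebraMap ℂ K 2) := by
      rw [map_ofNat, map_ofNat]
    rw [this, ← C_mul, ← map_mul]; norm_num
  obtain ⟨t1, t2, t3, t4⟩ := P.ts_eq
  have hid : ∀ a, opPath P (idp a) = LinearMap.id := fun a => rfl
  cases x <;> cases y <;> rename_i i j <;> fin_cases i <;> fin_cases j <;>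
    simp only [rule2, ruleZZ, ruleWW, ruleZW11, ruleWZ11, ruleWZ00, ruleZW22, Fin.zero_eta,
      Fin.mk_one, Fin.reduceFinMk, Option.some.injEq, reduceCtorEq] at h <;>
    subst h <;>
    simp only [map_add, map_sub, map_neg, opLin_single, zz, ww, wz11, zw22, wz00,
      opPath_path2, op, Fin.zero_eta, Fin.mk_one, Fin.reduceFinMk, hid, one_smul] <;>
    refine LinearMap.ext fun F => ?_ <;>
    simp only [LinearMap.add_apply, LinearMap.sub_apply, LinearMap.neg_apply,
      LinearMap.smul_apply, LinearMap.comp_apply, LinearMap.id_apply, MvPolynomial.smul_eq_C_mul,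
      opZ_zero_apply, opZ_one_apply, opZ_two_apply, opW_zero_apply, opW_one_apply, opW_two_apply,
      map_add, map_sub, map_mul, map_pow, Derivation.leibniz, Derivation.leibniz_pow, smul_eq_mul,
      pderiv_x0_x1, pderiv_x1_x0, pderiv_x_y, pderiv_X_self, pderiv_C,
      twA_C, twA_x0, twA_x1, twA_y0, twA_y1, pderiv0_twA, pderiv1_twA,
      twA'_C, twA'_x0, twA'_x1, twA'_y0, twA'_y1, pderiv0_twA', pderiv1_twA',
      twB_C, twB_x, twB_y, pderiv_twB, twB'_C, twB'_x, twB'_y, pderiv_twB',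
      twA_twA', twA'_twA, twB_twB', twB'_twB, twB_twA, twB_twA', twB'_twA, twB'_twA',
      -- Mixed second derivatives are brought to one fixed order, so that the final identity is one
      -- of polynomials in atoms.
      pderiv_comm (.inl 1) (.inl 0) F, t1, t2, t3, t4] <;>
    clear t1 t2 t3 t4 hid <;>
    grind

theorem opLin_eq_zero {a b : Node} {f : Lin K a b} (hf : f ∈ essIdeal P a b) :
    opLin P a b f = 0 := by
  have : essIdeal P a b ≤ LinearMap.ker (opLin P a b) := by
    refine relIdeal_le ?_
    rintro c d v r u ⟨e, x, y, g, hg, rfl⟩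
    rw [LinearMap.mem_ker, opLin_concat, opLin_concat, map_sub, opLin_rule2 P x y hg,
      opLin_single P (path2 x y), one_smul, opPath_path2, sub_self, LinearMap.zero_comp,
      LinearMap.comp_zero]
  exact this hf

end Representation

/-! ### Leading terms and linear independence of irreducible paths -/

section Leading

open MvPolynomial

variable {K : Type u} [CommRing K]

/-- The weight of a monomial, with `x¹` of weight `2` and `x², ξ₁, ξ₂` of weight `1`. -/
def wt (m : Fin 2 ⊕ Fin 2 →₀ ℕ) : ℕ :=
  2 * m (.inl 0) + m (.inl 1) + m (.inr 0) + m (.inr 1)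

theorem wt_add (m n : Fin 2 ⊕ Fin 2 →₀ ℕ) : wt (m + n) = wt m + wt n := by
  simp only [wt, Finsupp.add_apply]; ring

theorem wt_mono {m n : Fin 2 ⊕ Fin 2 →₀ ℕ} (h : m ≤ n) : wt m ≤ wt n := by
  have h1 := h (.inl 0)
  have h2 := h (.inl 1)
  have h3 := h (.inr 0)
  have h4 := h (.inr 1)
  unfold wt; omega

theorem wt_single_x0 : wt (.single (.inl 0) 1) = 2 := by simp [wt]
theorem wt_single_x1 : wt (.single (.inl 1) 1) = 1 := by simp [wt]
theorem wt_single_y (i : Fin 2) : wt (.single (.inr i) 1) = 1 := by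
  fin_cases i <;> simp [wt]

/-- Polynomials whose monomials have weight less than `n`. -/
noncomputable def lower (K : Type u) [CommRing K] (n : ℕ) : Submodule K (Fun K) where
  carrier := {F | ∀ m, n ≤ wt m → coeff m F = 0}
  zero_mem' := fun m _ => coeff_zero m
  add_mem' := fun hF hG m hm => by rw [coeff_add, hF m hm, hG m hm, add_zero]
  smul_mem' := fun c F hF m hm => by rw [coeff_smul, hF m hm, smul_zero]

theorem monomial_mem_lower {m : Fin 2 ⊕ Fin 2 →₀ ℕ} {n : ℕ} (h : wt m < n) (c : K) :
    monomial m c ∈ lower K n := fun k hk => by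
  classical
  rw [coeff_monomial, if_neg]
  rintro rfl
  omega

theorem lower_mono {m n : ℕ} (h : m ≤ n) : lower K m ≤ lower K n :=
  fun _ hF k hk => hF k (h.trans hk)

/-- Since `lower` is a strict bound, the hypothesis with `+ 1` says that T raises weights by at most
k. -/
theorem map_mem_lower {n k : ℕ} (T : Fun K →ₗ[K] Fun K)
    (hT : ∀ m c, T (monomial m c) ∈ lower K (wt m + k + 1)) {F : Fun K} (hF : F ∈ lower K n) :
    T F ∈ lower K (n + k) := by
  rw [F.as_sum, map_sum]
  refine Submodule.sum_mem _ fun m hm => ?_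
  have : wt m < n := by
    by_contra h
    exact mem_support_iff.1 hm (hF m (not_lt.1 h))
  exact lower_mono (by omega) (hT m _)

theorem scale_monomial (v : Fin 2 → Kˣ) (m : Fin 2 ⊕ Fin 2 →₀ ℕ) :
    ∃ u : Kˣ, ∀ c : K, scale v (monomial m c) = monomial m (u * c) := by
  suffices ∃ u : Kˣ, scale v (monomial m 1) = monomial m (u : K) by
    obtain ⟨u, hu⟩ := this
    refine ⟨u, fun c => ?_⟩
    have : (monomial m c : Fun K) = c • monomial m 1 := by simp [smul_monomial]
    rw [this, map_smul, hu, smul_monomial, smul_eq_mul, mul_comm]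
  induction m using Finsupp.induction_linear with
  | zero => exact ⟨1, by simp⟩
  | add m n hm hn =>
    obtain ⟨u, hu⟩ := hm
    obtain ⟨v, hv⟩ := hn
    refine ⟨u * v, ?_⟩
    rw [← mul_one (1 : K), ← monomial_mul, map_mul, hu, hv, monomial_mul, Units.val_mul]
  | single i n =>
    rw [← X_pow_eq_monomial]
    rcases i with i | i
    · refine ⟨v i ^ n, ?_⟩
      rw [map_pow, scale_X_inl, mul_pow, ← C_pow, X_pow_eq_monomial, C_mul_monomial, mul_one,
        Units.val_pow_eq_pow_val]
    · refine ⟨(v i)⁻¹ ^ n, ?_⟩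
      rw [map_pow, scale_X_inr, mul_pow, ← C_pow, X_pow_eq_monomial, C_mul_monomial, mul_one,
        Units.val_pow_eq_pow_val]

theorem momentum_monomial (s : K) (i : Fin 2) (m : Fin 2 ⊕ Fin 2 →₀ ℕ) (c : K) :
    ∃ c', momentum s i (monomial m c) =
      monomial (m + .single (.inr i) 1) c + monomial (m - .single (.inl i) 1) c' := by
  -- When x^i is absent from m the truncated subtraction leaves m unchanged, but then this
  -- coefficient is zero.
  refine ⟨s * (c * (m (.inl i) : K)), ?_⟩
  rw [momentum_apply, pderiv_monomial, C_mul_monomial, X, monomial_mul, one_mul, add_comm m]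

theorem wt_sub_le (m n : Fin 2 ⊕ Fin 2 →₀ ℕ) : wt (m - n) ≤ wt m := wt_mono tsub_le_self

variable [Algebra ℂ K] (P : Params K)

theorem Params.Q_pow (d : ℕ) : P.Q ^ d = (P.q ^ d : Kˣ) := by simp [Params.Q]
theorem Params.Qi_pow (d : ℕ) : P.Qi ^ d = ((P.q⁻¹) ^ d : Kˣ) := by
  rw [Params.Qi, Units.val_pow_eq_pow_val]

theorem opZ_monomial (d : ℕ) (i : Fin 3) (m : Fin 2 ⊕ Fin 2 →₀ ℕ) :
    ∃ u : Kˣ, ∀ c, opZ P d i (monomial m c) =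
      monomial (m + ![.single (.inl 0) 1, .single (.inl 1) 1, 0] i) (u * c) := by
  fin_cases i
  · obtain ⟨u, hu⟩ := scale_monomial ![P.q⁻¹, (P.q ^ 2)⁻¹] m
    refine ⟨P.q ^ d * u, fun c => ?_⟩
    simp only [Fin.zero_eta, opZ_zero_apply, twA, hu, ← C_pow, P.Q_pow, X, C_mul_monomial,
      monomial_mul, mul_one, Units.val_mul, mul_assoc, add_comm m]
    rfl
  · obtain ⟨u, hu⟩ := scale_monomial ![P.q, P.q] m
    refine ⟨P.q⁻¹ ^ d * u, fun c => ?_⟩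
    simp only [Fin.mk_one, opZ_one_apply, twB, hu, ← C_pow, P.Qi_pow, X, C_mul_monomial,
      monomial_mul, mul_one, Units.val_mul, mul_assoc, add_comm m]
    rfl
  · exact ⟨1, fun c => by simp [opZ]⟩

/-- Giving x¹ weight 2 makes −x¹ξ₁, of weight 3, dominate in w₃: x²ξ₂ has weight 2, and x^i ∂_{x^i}
and κ do not raise the weight. For w₁ and w₂ the term ξ_i dominates the derivative. -/
theorem opW_monomial (d : ℕ) (κ : K) (i : Fin 3) (m : Fin 2 ⊕ Fin 2 →₀ ℕ) :
    ∃ u : Kˣ, ∀ c, opW P d κ i (monomial m c) -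
      monomial (m + ![.single (.inr 0) 1, .single (.inr 1) 1,
        .single (.inl 0) 1 + .single (.inr 0) 1] i) (u * c) ∈
      lower K (wt m + wt (![.single (.inr 0) 1, .single (.inr 1) 1,
        .single (.inl 0) 1 + .single (.inr 0) 1] i)) := by
  fin_cases i
  · obtain ⟨u, hu⟩ := scale_monomial ![P.q, P.q ^ 2] m
    refine ⟨P.q⁻¹ ^ d * u, fun c => ?_⟩
    obtain ⟨c', hc'⟩ := momentum_monomial P.s 0 m (u * c)
    have : opW P d κ 0 (monomial m c) =
        monomial (m + .single (.inr 0) 1) (((P.q⁻¹ ^ d * u : Kˣ) : K) * c) +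
          monomial (m - .single (.inl 0) 1) (P.Qi ^ d * c') := by
      rw [opW_zero_apply, twA', hu, ← momentum_apply, hc', mul_add, ← C_pow, C_mul_monomial,
        C_mul_monomial, Units.val_mul, ← P.Qi_pow, mul_assoc]
    simp only [Fin.zero_eta, Matrix.cons_val_zero]
    rw [this, add_sub_cancel_left, wt_single_y]
    exact monomial_mem_lower (Nat.lt_succ_of_le (wt_sub_le _ _)) _
  · obtain ⟨u, hu⟩ := scale_monomial ![P.q⁻¹, P.q⁻¹] m
    refine ⟨P.q ^ d * u, fun c => ?_⟩
    obtain ⟨c', hc'⟩ := momentum_monomial P.s 1 m (u * c)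
    have : opW P d κ 1 (monomial m c) =
        monomial (m + .single (.inr 1) 1) (((P.q ^ d * u : Kˣ) : K) * c) +
          monomial (m - .single (.inl 1) 1) (P.Q ^ d * c') := by
      rw [opW_one_apply, twB', hu, ← momentum_apply, hc', mul_add, ← C_pow, C_mul_monomial,
        C_mul_monomial, Units.val_mul, ← P.Q_pow, mul_assoc]
    simp only [Fin.mk_one, Matrix.cons_val_one, Matrix.cons_val_zero]
    rw [this, add_sub_cancel_left, wt_single_y]
    exact monomial_mem_lower (Nat.lt_succ_of_le (wt_sub_le _ _)) _
  · refine ⟨-1, fun c => ?_⟩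
    obtain ⟨c', hc'⟩ := momentum_monomial P.s 0 m c
    obtain ⟨c'', hc''⟩ := momentum_monomial P.s 1 m c
    have : opW P d κ 2 (monomial m c) =
        monomial m (κ * c) - (monomial (.single (.inl 0) 1 + (m + .single (.inr 0) 1)) c +
          monomial (.single (.inl 0) 1 + (m - .single (.inl 0) 1)) c') -
          (monomial (.single (.inl 1) 1 + (m + .single (.inr 1) 1)) c +
          monomial (.single (.inl 1) 1 + (m - .single (.inl 1) 1)) c'') := by
      rw [opW_two_apply, ← momentum_apply, ← momentum_apply, hc', hc'', C_mul_monomial, X, X,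
        mul_add, mul_add, monomial_mul, monomial_mul, monomial_mul, monomial_mul]
      simp only [one_mul]
    have hm : m + (Finsupp.single (.inl 0) 1 + Finsupp.single (.inr 0) 1) =
        Finsupp.single (.inl 0) 1 + (m + Finsupp.single (.inr 0) 1) := by abel
    have hneg : (((-1 : Kˣ) : K) * c) = -c := by simp
    have h2 : ![(.single (.inr 0) 1 : Fin 2 ⊕ Fin 2 →₀ ℕ), .single (.inr 1) 1,
        .single (.inl 0) 1 + .single (.inr 0) 1] 2 = .single (.inl 0) 1 + .single (.inr 0) 1 := rfl
    simp only [Fin.reduceFinMk, h2, hm, hneg, this, wt_add, wt_single_x0, wt_single_y, map_neg]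
    have e1 := wt_sub_le m (.single (.inl 0) 1)
    have e2 := wt_sub_le m (.single (.inl 1) 1)
    have a1 : monomial m (κ * c) ∈ lower K (wt m + (2 + 1)) := monomial_mem_lower (by omega) _
    have a2 : monomial (.single (.inl 0) 1 + (m - .single (.inl 0) 1)) c' ∈
        lower K (wt m + (2 + 1)) :=
      monomial_mem_lower (by rw [wt_add, wt_single_x0]; omega) _
    have a3 : monomial (.single (.inl 1) 1 + (m + .single (.inr 1) 1)) c ∈
        lower K (wt m + (2 + 1)) :=
      monomial_mem_lower (by rw [wt_add, wt_add, wt_single_x1, wt_single_y]; omega) _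
    have a4 : monomial (.single (.inl 1) 1 + (m - .single (.inl 1) 1)) c'' ∈
        lower K (wt m + (2 + 1)) :=
      monomial_mem_lower (by rw [wt_add, wt_single_x1]; omega) _
    convert sub_mem (sub_mem a1 a2) (add_mem a3 a4) using 1
    abel

theorem op_monomial {a b : Node} (x : Arrow a b) (m : Fin 2 ⊕ Fin 2 →₀ ℕ) :
    ∃ u : Kˣ, ∀ c, op P x (monomial m c) - monomial (m + x.lead) (u * c) ∈
      lower K (wt m + wt x.lead) := by
  cases x with
  | z01 i =>
    obtain ⟨u, hu⟩ := opZ_monomial P 0 i m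
    exact ⟨u, fun c => by rw [op, hu, Arrow.lead, sub_self]; exact zero_mem _⟩
  | z12 i =>
    obtain ⟨u, hu⟩ := opZ_monomial P 1 i m
    exact ⟨u, fun c => by rw [op, hu, Arrow.lead, sub_self]; exact zero_mem _⟩
  | w10 i => exact opW_monomial P 1 _ i m
  | w21 i => exact opW_monomial P 2 _ i m

theorem op_mem_lower {a b : Node} (x : Arrow a b) {n : ℕ} {F : Fun K} (hF : F ∈ lower K n) :
    op P x F ∈ lower K (n + wt x.lead) := by
  refine map_mem_lower _ (fun m c => ?_) hF
  obtain ⟨u, hu⟩ := op_monomial P x m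
  rw [← sub_add_cancel (op P x (monomial m c)) (monomial (m + x.lead) (u * c))]
  exact add_mem (lower_mono (Nat.le_succ _) (hu c))
    (monomial_mem_lower (by rw [wt_add]; exact Nat.lt_succ_self _) _)

/-- The function on the chart given by a linear combination of paths. -/
noncomputable def symb (a b : Node) : Lin K a b →ₗ[K] Fun K :=
  LinearMap.applyₗ (1 : Fun K) ∘ₗ opLin P a b

theorem symb_apply {a b : Node} (f : Lin K a b) : symb P a b f = opLin P a b f 1 := rfl

/-- Leading monomials add and leading coefficients multiply along a path. Because the coefficients
are units, they cannot be cancelled even when K has zero divisors. -/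
theorem opPath_one_lead {a b : Node} (p : Path a b) :
    ∃ u : Kˣ, opPath P p 1 - monomial (lead p) (u : K) ∈ lower K (wt (lead p)) := by
  induction p with
  | nil =>
    refine ⟨1, ?_⟩
    have : opPath P (Path.nil : Path a a) 1 = monomial 0 (1 : K) := rfl
    rw [this, Units.val_one, lead, sub_self]
    exact zero_mem _
  | cons p x ih =>
    change Arrow _ _ at x
    obtain ⟨u, hu⟩ := ih
    obtain ⟨v, hv⟩ := op_monomial P x (lead p)
    refine ⟨v * u, ?_⟩
    have h1 := op_mem_lower P x hu
    rw [map_sub] at h1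
    have h2 := add_mem h1 (hv u)
    rw [sub_add_sub_cancel] at h2
    rw [lead, wt_add, Units.val_mul]
    exact h2

/-- Irreducible paths are linearly independent as functions on the chart. -/
theorem eq_zero_of_symb_eq_zero {a b : Node} {f : Lin K a b} (hf : f ∈ irr P a b)
    (h : symb P a b f = 0) : f = 0 := by
  classical
  by_contra hne
  -- Take p in the support with leading monomial of maximal weight. No other path contributes to
  -- that monomial: its lower terms have strictly smaller weight, and its leading monomial is
  -- different.
  obtain ⟨p, hp, hmax⟩ := f.support.exists_max_image (fun p => wt (lead p))
    (Finsupp.support_nonempty_iff.2 hne)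
  obtain ⟨u, hu⟩ := opPath_one_lead P p
  have hpc : coeff (lead p) (opPath P p 1) = u := by
    have := hu (lead p) le_rfl
    rwa [coeff_sub, coeff_monomial, if_pos rfl, sub_eq_zero] at this
  have hrc : ∀ r ∈ f.support, r ≠ p → coeff (lead p) (opPath P r 1) = 0 := by
    intro r hr hrp
    obtain ⟨v, hv⟩ := opPath_one_lead P r
    have := hv (lead p) (hmax r hr)
    rwa [coeff_sub, coeff_monomial, if_neg fun e => hrp (eq_of_lead_eq (hf hr) (hf hp) e),
      sub_zero] at this
  have hc := congrArg (coeff (lead p)) h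
  rw [symb_apply, opLin, Finsupp.linearCombination_apply, Finsupp.sum, LinearMap.sum_apply,
    coeff_sum, Finset.sum_eq_single_of_mem p hp, LinearMap.smul_apply, coeff_smul, hpc,
    coeff_zero, smul_eq_mul, Units.mul_left_eq_zero] at hc
  · exact Finsupp.mem_support_iff.1 hp hc
  · intro r hr hrp
    rw [LinearMap.smul_apply, coeff_smul, hrc r hr hrp, smul_zero]

end Leading

/-! ### The basis theorem and associativity of the star product -/

section Star

variable {K : Type u} [CommRing K] [Algebra ℂ K] (P : Params K)

theorem symb_eq_zero_of_mem {a b : Node} {f : Lin K a b} (hf : f ∈ essIdeal P a b) :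
    symb P a b f = 0 := by
  rw [symb_apply, opLin_eq_zero P hf, LinearMap.zero_apply]

/-- The symbol kills the ideal and is injective on irreducible combinations, so they meet only in 0;
right reduction shows that together they span. -/
theorem isCompl_irr_essIdeal (a b : Node) : IsCompl (irr P a b) (essIdeal P a b) := by
  refine IsCompl.of_eq ?_ ?_
  · rw [eq_bot_iff]
    rintro f ⟨h1, h2⟩
    exact eq_zero_of_symb_eq_zero P h1 (symb_eq_zero_of_mem P h2)
  · rw [eq_top_iff]
    intro f _
    rw [← add_sub_cancel (redR P f) f]
    exact Submodule.add_mem_sup (redR_mem_irr P f) (sub_redR_mem P f)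

theorem eq_of_sub_mem {a b : Node} {f g : Lin K a b} (hf : f ∈ irr P a b) (hg : g ∈ irr P a b)
    (h : f - g ∈ essIdeal P a b) : f = g :=
  sub_eq_zero.1 ((Submodule.disjoint_def.1 (isCompl_irr_essIdeal P a b).disjoint) _
    (sub_mem hf hg) h)

/-- Faithfulness of the representation already on the vector 1: reducing f changes neither its class
nor its symbol. -/
theorem mem_essIdeal_iff {a b : Node} {f : Lin K a b} : f ∈ essIdeal P a b ↔ symb P a b f = 0 := by
  refine ⟨symb_eq_zero_of_mem P, fun h => ?_⟩
  have h1 := sub_redR_mem P f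
  have h2 := symb_eq_zero_of_mem P h1
  rw [map_sub, h, zero_sub, neg_eq_zero] at h2
  rwa [eq_zero_of_symb_eq_zero P (redR_mem_irr P f) h2, sub_zero] at h1

theorem star_mem_irr {a b c : Node} (u : Lin K b c) (v : Lin K a b) : star P u v ∈ irr P a c :=
  redR_mem_irr P _

theorem concat_sub_star_mem {a b c : Node} (u : Lin K b c) (v : Lin K a b) :
    concat u v - star P u v ∈ essIdeal P a c := sub_redR_mem P _

theorem star_idp {a b : Node} {u : Lin K a b} (hu : u ∈ irr P a b) :
    star P u (mon 1 (idp a)) = u := by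
  rw [star, concat_idp_right, redR_of_mem_irr P hu]

theorem idp_star {a b : Node} {u : Lin K a b} (hu : u ∈ irr P a b) :
    star P (mon 1 (idp b)) u = u := by
  rw [star, concat_idp_left, redR_of_mem_irr P hu]

/-- Both sides are irreducible representatives of the class of the concatenation u v w, and such a
representative is unique. -/
theorem star_assoc {a b c d : Node} (u : Lin K c d) (v : Lin K b c) (w : Lin K a b) :
    star P (star P u v) w = star P u (star P v w) := by
  refine eq_of_sub_mem P (star_mem_irr P _ _) (star_mem_irr P _ _) ?_
  have h1 := concat_sub_star_mem P (star P u v) w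
  have h2 := concat_sub_star_mem P u (star P v w)
  have h3 := concat_mem_relIdeal_right w (concat_sub_star_mem P u v)
  have h4 := concat_mem_relIdeal_left u (concat_sub_star_mem P v w)
  rw [concat_sub_left, concat_assoc] at h3
  rw [concat_sub_right] at h4
  convert sub_mem (add_mem h2 h4) (add_mem h1 h3) using 1
  abel

end Star

/-! ### The undeformed algebra and the coordinate ring -/

section Geometric

open MvPolynomial

variable {K : Type u} [CommRing K]

section Eval

variable {R : Type v} [CommRing R] (ζ ω : Fin 3 → R)

theorem evalPath_nil (a : Node) : evalPath ζ ω (Path.nil : Path a a) = 1 := by rw [evalPath]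

theorem evalPath_cons {a b c : Node} (p : Path a b) (x : Arrow b c) :
    evalPath ζ ω (p.cons x.hom) = Arrow.val ζ ω x * evalPath ζ ω p := by rw [evalPath]; rfl

theorem evalPath_comp {a b c : Node} (p : Path a b) (r : Path b c) :
    evalPath ζ ω (p.comp r) = evalPath ζ ω r * evalPath ζ ω p := by
  induction r with
  | nil => rw [Path.comp_nil, evalPath_nil, one_mul]
  | cons r x ih => rw [Path.comp_cons, evalPath, evalPath, ih, mul_assoc]

theorem evalPath_path2 {a b c : Node} (x : Arrow a b) (y : Arrow b c) :
    evalPath ζ ω (path2 x y) = Arrow.val ζ ω y * Arrow.val ζ ω x := by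
  rw [path2, evalPath_cons, evalPath_cons, evalPath_nil, mul_one]

theorem map_arrowVal {S : Type*} (φ : R → S) {a b : Node} (x : Arrow a b) :
    φ (Arrow.val ζ ω x) = Arrow.val (φ ∘ ζ) (φ ∘ ω) x := by
  cases x <;> rfl

theorem map_evalPath {S : Type*} [CommRing S] (φ : R →+* S) {a b : Node} (p : Path a b) :
    φ (evalPath ζ ω p) = evalPath (φ ∘ ζ) (φ ∘ ω) p := by
  induction p with
  | nil => rw [evalPath_nil, evalPath_nil, map_one]
  | cons p x ih => rw [evalPath, evalPath, map_mul, ih, map_arrowVal ζ ω φ]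

variable [Algebra K R]

theorem evalLin_single {a b : Node} (p : Path a b) (c : K) :
    evalLin ζ ω a b (Finsupp.single p c) = c • evalPath ζ ω p := by
  simp [evalLin]

theorem map_evalLin {S : Type*} [CommRing S] [Algebra K S] (φ : R →ₐ[K] S) {a b : Node}
    (f : Lin K a b) : φ (evalLin ζ ω a b f) = evalLin (φ ∘ ζ) (φ ∘ ω) a b f := by
  induction f using Finsupp.induction_linear with
  | zero => simp
  | add f g hf hg => simp only [map_add, hf, hg]
  | single p c =>
    rw [evalLin_single, evalLin_single, map_smul]
    exact congrArg _ (map_evalPath ζ ω φ.toRingHom p)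

theorem evalLin_concat {a b c : Node} (u : Lin K b c) (v : Lin K a b) :
    evalLin ζ ω a c (concat u v) = evalLin ζ ω b c u * evalLin ζ ω a b v := by
  induction u using Finsupp.induction_linear with
  | zero => simp [concat_zero_left]
  | add u u' h h' => rw [concat_add_left, map_add, h, h', map_add, add_mul]
  | single r y =>
    induction v using Finsupp.induction_linear with
    | zero => simp [concat_zero_right]
    | add u u' h h' => rw [concat_add_right, map_add, h, h', map_add, mul_add]
    | single p x =>
      rw [concat_single, evalLin_single, evalLin_single, evalLin_single, evalPath_comp,
        smul_mul_smul_comm]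

/-- The quiver relations hold for commuting values with `∑ w_i z^i = t`. -/
theorem evalLin_eq_zero_of_mem_quiverIdeal {t : K} (h : ∑ i, ω i * ζ i = algebraMap K R t)
    {a b : Node} {f : Lin K a b} (hf : f ∈ relIdeal (quiverRel t) a b) :
    evalLin ζ ω a b f = 0 := by
  have h' : ∑ i, ζ i * ω i = algebraMap K R t := by simpa only [mul_comm] using h
  have hid : ∀ a, evalPath ζ ω (idp a) = 1 := evalPath_nil ζ ω
  have key : ∀ a b (r : Lin K a b), r ∈ quiverRel t a b → evalLin ζ ω a b r = 0 := by
    rintro (_ | _ | _) (_ | _ | _) r hr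
    · obtain rfl : r = _ := hr
      simp [evalLin_single, wz00, evalPath_path2, Arrow.val, h, hid,
        Algebra.algebraMap_eq_smul_one]
    · exact hr.elim
    · obtain ⟨i, j, rfl⟩ := hr
      simp [evalLin_single, zz, evalPath_path2, Arrow.val, mul_comm]
    · exact hr.elim
    · rcases hr with ⟨i, j, rfl⟩ | rfl | rfl
      · simp [evalLin_single, zw11, wz11, evalPath_path2, Arrow.val, mul_comm]
      · simp [evalLin_single, zw11, evalPath_path2, Arrow.val, h', hid,
          Algebra.algebraMap_eq_smul_one]
      · simp [evalLin_single, wz11, evalPath_path2, Arrow.val, h, hid,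
          Algebra.algebraMap_eq_smul_one]
    · exact hr.elim
    · obtain ⟨i, j, rfl⟩ := hr
      simp [evalLin_single, ww, evalPath_path2, Arrow.val, mul_comm]
    · exact hr.elim
    · obtain rfl : r = _ := hr
      simp [evalLin_single, zw22, evalPath_path2, Arrow.val, h', hid,
        Algebra.algebraMap_eq_smul_one]
  have : relIdeal (quiverRel t) a b ≤ LinearMap.ker (evalLin (K := K) ζ ω a b) := by
    refine relIdeal_le fun c d v r u hr => ?_
    rw [LinearMap.mem_ker, evalLin_concat, evalLin_concat, key c d r hr, zero_mul, mul_zero]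
  exact this hf

end Eval

/-- The values of `z^i` on the chart `z³ = 1`. -/
noncomputable def chartZ (K : Type u) [CommRing K] : Fin 3 → Fun K := ![X (.inl 0), X (.inl 1), 1]
/-- The values of `w_i` on the chart `z³ = 1` of `∑ w_i z^i = t`. -/
noncomputable def chartW (t : K) : Fin 3 → Fun K :=
  ![X (.inr 0), X (.inr 1), C t - X (.inl 0) * X (.inr 0) - X (.inl 1) * X (.inr 1)]

theorem scale_eq_self {u : Fin 2 → Kˣ} (hu : ∀ i, u i = 1) (F : Fun K) : scale u F = F := by
  rw [show u = 1 from funext hu, scale_one]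

theorem sum_chartW_mul_chartZ (t : K) : ∑ i, chartW t i * chartZ K i = algebraMap K (Fun K) t := by
  simp [Fin.sum_univ_three, chartW, chartZ, algebraMap_eq]
  ring

variable [Algebra ℂ K] (t : K)

/-- The undeformed parameters. -/
abbrev classical (t : K) : Params K := ⟨1, 0, t⟩

theorem classical_Q : (classical t).Q = 1 := Units.val_one
theorem classical_Qi : (classical t).Qi = 1 := by simp [Params.Qi]
theorem classical_ts (r : ℂ) : (classical t).ts r = t := by simp [Params.ts]

/-- At q = 1 the twists are trivial and at s = 0 the derivatives disappear, so every arrow acts by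
multiplication. -/
theorem op_classical {a b : Node} (x : Arrow a b) (F : Fun K) :
    op (classical t) x F = Arrow.val (chartZ K) (chartW t) x * F := by
  have hA : twA (classical t) F = F := scale_eq_self (fun i => by fin_cases i <;> simp) F
  have hA' : twA' (classical t) F = F := scale_eq_self (fun i => by fin_cases i <;> simp) F
  have hB : twB (classical t) F = F := scale_eq_self (fun i => by fin_cases i <;> simp) F
  have hB' : twB' (classical t) F = F := scale_eq_self (fun i => by fin_cases i <;> simp) F
  cases x <;> rename_i i <;> fin_cases i <;>
    simp only [op, Fin.zero_eta, Fin.mk_one, Fin.reduceFinMk, opZ_zero_apply, opZ_one_apply,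
      opZ_two_apply, opW_zero_apply, opW_one_apply, opW_two_apply, classical_Q, classical_Qi,
      classical_ts, hA, hA', hB, hB'] <;>
    simp [Arrow.val, chartZ, chartW] <;> ring

theorem opPath_classical {a b : Node} (p : Path a b) (F : Fun K) :
    opPath (classical t) p F = evalPath (chartZ K) (chartW t) p * F := by
  induction p with
  | nil => rw [evalPath_nil, one_mul]; rfl
  | cons p x ih =>
    rw [opPath, LinearMap.comp_apply, ih, op_classical, evalPath, mul_assoc]

theorem symb_classical {a b : Node} (f : Lin K a b) :
    symb (classical t) a b f = evalLin (chartZ K) (chartW t) a b f := by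
  rw [symb_apply]
  induction f using Finsupp.induction_linear with
  | zero => simp
  | add f g hf hg => rw [map_add, map_add, ← hf, ← hg, LinearMap.add_apply]
  | single p c =>
    rw [opLin_single, evalLin_single, LinearMap.smul_apply, opPath_classical, mul_one]

theorem rule2_classical_mem {a b c : Node} (x : Arrow a b) (y : Arrow b c) {f : Lin K a c}
    (h : rule2 (classical t) x y = some f) :
    mon 1 (path2 x y) - f ∈ relIdeal (quiverRel t) a c := by
  have hz : ∀ i j, mon 1 (zz i j) - mon 1 (zz j i) ∈ relIdeal (quiverRel t) e0 e2 :=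
    fun i j => subset_relIdeal ⟨i, j, rfl⟩
  have hw : ∀ i j, mon 1 (ww i j) - mon 1 (ww j i) ∈ relIdeal (quiverRel t) e2 e0 :=
    fun i j => subset_relIdeal ⟨i, j, rfl⟩
  have hzw : ∀ i j, mon 1 (zw11 i j) - mon 1 (wz11 j i) ∈ relIdeal (quiverRel t) e1 e1 :=
    fun i j => subset_relIdeal (Or.inl ⟨i, j, rfl⟩)
  have s11 : ∑ i, mon 1 (wz11 i i) - mon t (idp e1) ∈ relIdeal (quiverRel t) e1 e1 :=
    subset_relIdeal (Or.inr (Or.inr rfl))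
  have s00 : ∑ i, mon 1 (wz00 i i) - mon t (idp e0) ∈ relIdeal (quiverRel t) e0 e0 :=
    subset_relIdeal rfl
  have s22 : ∑ i, mon 1 (zw22 i i) - mon t (idp e2) ∈ relIdeal (quiverRel t) e2 e2 :=
    subset_relIdeal rfl
  rw [Fin.sum_univ_three] at s11 s00 s22
  cases x <;> cases y <;> rename_i i j <;> fin_cases i <;> fin_cases j <;>
    simp only [rule2, ruleZZ, ruleWW, ruleZW11, ruleWZ11, ruleWZ00, ruleZW22, Fin.zero_eta,
      Fin.mk_one, Fin.reduceFinMk, Option.some.injEq, reduceCtorEq] at h <;>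
    subst h <;>
    simp only [classical_Q, classical_Qi, classical_ts, Finsupp.single_zero, sub_zero,
      Fin.zero_eta, Fin.mk_one, Fin.reduceFinMk] <;>
    first
      | exact hz _ _
      | exact hw _ _
      | exact hzw _ _
      | (convert s00 using 1; simp only [wz00]; abel1)
      | (convert s22 using 1; simp only [zw22]; abel1)
      | (convert s11 using 1; simp only [wz11]; abel1)
      -- The rule for z³w₃ at e₁ combines the commutation of z³ with w₃ and the relation ∑ w_i z^i =
      -- t.
      | (convert add_mem s11 (hzw 2 2) using 1; simp only [zw11, wz11]; abel1)

/-- One inclusion is checked rule by rule. The other uses faithfulness: evaluation on the chart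
kills the quiver relations, and its kernel is the ideal of the essential rules. -/
theorem essIdeal_classical (a b : Node) :
    essIdeal (classical t) a b = relIdeal (quiverRel t) a b := by
  refine le_antisymm (relIdeal_mono ?_ a b) fun f hf => ?_
  · rintro a b _ ⟨c, x, y, f, h, rfl⟩
    exact rule2_classical_mem t x y h
  · rw [mem_essIdeal_iff, symb_classical]
    exact evalLin_eq_zero_of_mem_quiverIdeal _ _ (sum_chartW_mul_chartZ t) hf

theorem sum_coordW_mul_coordZ : ∑ i, coordW t i * coordZ t i = algebraMap K (Coord t) t := by
  have h := Ideal.Quotient.eq_zero_iff_mem.2 (Ideal.subset_span (Set.mem_singleton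
    (∑ i : Fin 3, X (R := K) (Sum.inr i : Fin 3 ⊕ Fin 3) * X (Sum.inl i) - C t)))
  rw [map_sub, map_sum, sub_eq_zero] at h
  simp only [map_mul] at h
  exact h

/-- Restriction of functions to the chart `z³ = 1`. -/
noncomputable def restrictChart : Coord t →ₐ[K] Fun K :=
  Ideal.Quotient.liftₐ _ (aeval (Sum.elim (chartZ K) (chartW t))) fun F hF => by
    have : Ideal.span {∑ i : Fin 3, X (R := K) (Sum.inr i : Fin 3 ⊕ Fin 3) * X (Sum.inl i) - C t} ≤
        RingHom.ker (aeval (Sum.elim (chartZ K) (chartW t)) :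
          MvPolynomial (Fin 3 ⊕ Fin 3) K →ₐ[K] Fun K) := by
      rw [Ideal.span_singleton_le_iff_mem, RingHom.mem_ker]
      simpa [sub_eq_zero] using sum_chartW_mul_chartZ t
    exact this hF

theorem restrictChart_comp_coordZ : restrictChart t ∘ coordZ t = chartZ K := by
  funext i
  exact aeval_X _ _

theorem restrictChart_comp_coordW : restrictChart t ∘ coordW t = chartW t := by
  funext i
  exact aeval_X _ _

/-- Evaluation on the chart factors through the coordinate ring, so a combination vanishing there
has zero symbol. Injectivity of the restriction to the chart is not needed. -/
theorem ker_evalLin_coord (a b : Node) :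
    LinearMap.ker (evalLin (K := K) (coordZ t) (coordW t) a b) = relIdeal (quiverRel t) a b := by
  refine le_antisymm (fun f hf => ?_) fun f hf =>
    evalLin_eq_zero_of_mem_quiverIdeal _ _ (sum_coordW_mul_coordZ t) hf
  rw [← essIdeal_classical, mem_essIdeal_iff, symb_classical, ← restrictChart_comp_coordZ t,
    ← restrictChart_comp_coordW t, ← map_evalLin, LinearMap.mem_ker.1 hf, map_zero]

/-- The weights of `z^i` and `w_i`. -/
abbrev zwWeight : Fin 3 ⊕ Fin 3 → ℤ := Sum.elim (fun _ => 1) fun _ => -1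

theorem isWeightedHomogeneous_evalPath {a b : Node} (p : Path a b) :
    IsWeightedHomogeneous zwWeight
      (evalPath (fun i => X (R := K) (Sum.inl i : Fin 3 ⊕ Fin 3)) (fun i => X (Sum.inr i)) p)
      (b.pos - a.pos) := by
  induction p with
  | nil => rw [evalPath_nil, sub_self]; exact isWeightedHomogeneous_one _ _
  | cons p x ih =>
    change Arrow _ _ at x
    rw [evalPath]
    cases x <;> rename_i i
    · have e : Node.e1.pos - a.pos = zwWeight (Sum.inl i) + (Node.e0.pos - a.pos) := by
        simp only [Node.pos, Sum.elim_inl]; ring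
      rw [e]
      exact (isWeightedHomogeneous_X K zwWeight (Sum.inl i)).mul ih
    · have e : Node.e2.pos - a.pos = zwWeight (Sum.inl i) + (Node.e1.pos - a.pos) := by
        simp only [Node.pos, Sum.elim_inl]; ring
      rw [e]
      exact (isWeightedHomogeneous_X K zwWeight (Sum.inl i)).mul ih
    · have e : Node.e0.pos - a.pos = zwWeight (Sum.inr i) + (Node.e1.pos - a.pos) := by
        simp only [Node.pos, Sum.elim_inr]; ring
      rw [e]
      exact (isWeightedHomogeneous_X K zwWeight (Sum.inr i)).mul ih
    · have e : Node.e1.pos - a.pos = zwWeight (Sum.inr i) + (Node.e2.pos - a.pos) := by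
        simp only [Node.pos, Sum.elim_inr]; ring
      rw [e]
      exact (isWeightedHomogeneous_X K zwWeight (Sum.inr i)).mul ih

/-- Every product of letters of total weight `b - a` is the value of a path from `a` to `b`. -/
theorem exists_evalPath_eq_prod {R : Type v} [CommRing R] (ζ ω : Fin 3 → R) (a b : Node) :
    ∀ l m : List (Fin 3), (l.length : ℤ) - m.length = b.pos - a.pos →
      ∃ p : Path a b, evalPath ζ ω p = (l.map ζ).prod * (m.map ω).prod
  -- A pair z^i, w_j is spent on a detour from the end node b to a neighbour and back. Once one kind
  -- of letter is used up, at most two letters remain, and they lead directly from a to b.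
  | i :: l, j :: m, h => by
    obtain ⟨p, hp⟩ := exists_evalPath_eq_prod ζ ω a b l m (by
      rw [← h]; push_cast [List.length_cons]; ring)
    simp only [List.map_cons, List.prod_cons]
    cases b
    · refine ⟨(p.cons (Arrow.z01 i).hom).cons (Arrow.w10 j).hom, ?_⟩
      rw [evalPath_cons, evalPath_cons, hp, Arrow.val, Arrow.val]; ring
    · refine ⟨(p.cons (Arrow.z12 i).hom).cons (Arrow.w21 j).hom, ?_⟩
      rw [evalPath_cons, evalPath_cons, hp, Arrow.val, Arrow.val]; ring
    · refine ⟨(p.cons (Arrow.w21 j).hom).cons (Arrow.z12 i).hom, ?_⟩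
      rw [evalPath_cons, evalPath_cons, hp, Arrow.val, Arrow.val]; ring
  | [], [], h => by
    cases a <;> cases b <;> simp [Node.pos] at h
    all_goals exact ⟨Path.nil, by rw [evalPath_nil]; simp⟩
  | [], [j], h => by
    cases a <;> cases b <;> simp [Node.pos] at h
    · exact ⟨w01 j, by rw [w01, evalPath_cons, evalPath_nil, Arrow.val]; simp⟩
    · exact ⟨w12 j, by rw [w12, evalPath_cons, evalPath_nil, Arrow.val]; simp⟩
  | [i], [], h => by
    cases a <;> cases b <;> simp [Node.pos] at h
    · exact ⟨Path.nil.cons (Arrow.z01 i).hom, by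
        rw [evalPath_cons, evalPath_nil, Arrow.val]; simp⟩
    · exact ⟨z21 i, by rw [z21, evalPath_cons, evalPath_nil, Arrow.val]; simp⟩
  | [], [j, k], h => by
    cases a <;> cases b <;> simp [Node.pos] at h
    exact ⟨ww j k, by rw [ww, evalPath_path2, Arrow.val, Arrow.val]; simp⟩
  | [i, k], [], h => by
    cases a <;> cases b <;> simp [Node.pos] at h
    exact ⟨zz i k, by rw [zz, evalPath_path2, Arrow.val, Arrow.val]; simp⟩
  | [], _ :: _ :: _ :: _, h => by
    simp only [List.length_cons, List.length_nil] at h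
    cases a <;> cases b <;> simp only [Node.pos] at h <;> omega
  | _ :: _ :: _ :: _, [], h => by
    simp only [List.length_cons, List.length_nil] at h
    cases a <;> cases b <;> simp only [Node.pos] at h <;> omega

theorem monomial_eq_prod (m : Fin 3 ⊕ Fin 3 →₀ ℕ) :
    ∃ k l : List (Fin 3), Finsupp.weight zwWeight m = (k.length : ℤ) - l.length ∧
      monomial m (1 : K) = (k.map fun i => X (.inl i)).prod * (l.map fun i => X (.inr i)).prod := by
  induction m using Finsupp.induction_linear with
  | zero => exact ⟨[], [], by simp⟩
  | add m m' h h' =>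
    obtain ⟨k, l, hw, hm⟩ := h
    obtain ⟨k', l', hw', hm'⟩ := h'
    refine ⟨k ++ k', l ++ l', ?_, ?_⟩
    · rw [map_add, hw, hw']; push_cast [List.length_append]; ring
    · rw [← mul_one (1 : K), ← monomial_mul, hm, hm', List.map_append, List.map_append,
        List.prod_append, List.prod_append]
      ring
  | single i n =>
    rcases i with i | i
    · refine ⟨List.replicate n i, [], ?_, ?_⟩
      · simp [Finsupp.weight_single]
      · simp [X_pow_eq_monomial]
    · refine ⟨[], List.replicate n i, ?_, ?_⟩
      · simp [Finsupp.weight_single]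
      · simp [X_pow_eq_monomial]

/-- Paths have the weight given by their endpoints. Conversely each monomial of that weight is the
value of a path, before passing to the quotient ring. -/
theorem range_evalLin_coord (a b : Node) :
    LinearMap.range (evalLin (K := K) (coordZ t) (coordW t) a b)
      = weightPart t (b.pos - a.pos) := by
  have hmk : ∀ p : Path a b, Ideal.Quotient.mkₐ K _ (evalPath
      (fun i => X (R := K) (Sum.inl i : Fin 3 ⊕ Fin 3)) (fun i => X (Sum.inr i)) p) =
      evalPath (coordZ t) (coordW t) p := fun p => map_evalPath _ _ (Ideal.Quotient.mk _) p
  refine le_antisymm ?_ ?_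
  · rintro _ ⟨f, rfl⟩
    induction f using Finsupp.induction_linear with
    | zero => rw [map_zero]; exact zero_mem _
    | add f g hf hg => rw [map_add]; exact add_mem hf hg
    | single p c =>
      rw [evalLin_single, ← hmk]
      exact Submodule.smul_mem _ _ (Submodule.mem_map_of_mem
        ((mem_weightedHomogeneousSubmodule _ _ _ _).2 (isWeightedHomogeneous_evalPath p)))
  · rintro _ ⟨F, hF, rfl⟩
    rw [F.as_sum, map_sum]
    refine Submodule.sum_mem _ fun m hm => ?_
    have hw : Finsupp.weight zwWeight m = b.pos - a.pos := hF (mem_support_iff.1 hm)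
    obtain ⟨k, l, hkl, hprod⟩ := monomial_eq_prod (K := K) m
    obtain ⟨p, hp⟩ := exists_evalPath_eq_prod (fun i => X (R := K) (Sum.inl i : Fin 3 ⊕ Fin 3))
      (fun i => X (Sum.inr i)) a b k l (hkl.symm.trans hw)
    refine ⟨Finsupp.single p (coeff m F), ?_⟩
    have : monomial m (coeff m F) = coeff m F • monomial m (1 : K) := by simp [smul_monomial]
    rw [evalLin_single, ← hmk, hp, ← hprod, this, map_smul]
    rfl

end Geometric

/-! ### Tips are the same for all parameters -/

section Comparison

variable {K : Type u} [CommRing K] [Algebra ℂ K] {K' : Type v} [CommRing K'] [Algebra ℂ K']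
  {P : Params K} (P' : Params K')

theorem rule2_eq_none_of_params {a b c : Node} {x : Arrow a b} {y : Arrow b c}
    (h : rule2 P x y = none) : rule2 P' x y = none := by
  cases x <;> cases y <;> rename_i i j <;> fin_cases i <;> fin_cases j <;>
    first | rfl | cases h

theorem rule3_eq_none_of_params {a b c d : Node} {x : Arrow a b} {y : Arrow b c} {u : Arrow c d}
    (h : rule3 P x y u = none) : rule3 P' x y u = none := by
  cases x <;> cases y <;> cases u <;> try rfl
  all_goals
    rename_i i j k
    fin_cases i <;> fin_cases j <;> fin_cases k <;> first | rfl | cases h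

/-- Irreducibility of a path does not depend on the parameters. -/
theorem rightStep_eq_none_of_params {a b : Node} {p : Path a b} (h : rightStep P p = none) :
    rightStep P' p = none := by
  induction p with
  | nil => rw [rightStep]
  | cons p x ih =>
    rw [rightStep, ih (rightStep_tail h)]
    rcases p with _ | ⟨_ | ⟨p, y⟩, z⟩
    · rw [topRule]
    · rw [topRule]
      exact rule2_eq_none_of_params P' (rule2_eq_none (x := z) (y := x) h)
    · rw [topRule, rule2_eq_none_of_params P' (rule2_eq_none (x := z) (y := x) h)]
      exact Option.map_eq_none_iff.2
        (rule3_eq_none_of_params P' (rule3_eq_none (x := y) (y := z) (u := x) h))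

end Comparison

/-! ### Expansion of the operators to first order in ħ -/

section Semiclassical

open MvPolynomial

/-- The value of a function at `ħ = 0`. -/
noncomputable def c0 : Fun (PowerSeries ℂ) →+* Chart := MvPolynomial.map PowerSeries.constantCoeff

/-- The coefficient of `ħ` in a function. -/
noncomputable def c1 (F : Fun (PowerSeries ℂ)) : Chart :=
  ∑ m ∈ F.support, monomial m (PowerSeries.coeff 1 (coeff m F))

theorem coeff_c0 (m : Fin 2 ⊕ Fin 2 →₀ ℕ) (F : Fun (PowerSeries ℂ)) :
    coeff m (c0 F) = PowerSeries.coeff 0 (coeff m F) := by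
  rw [c0, coeff_map, PowerSeries.coeff_zero_eq_constantCoeff_apply]

theorem coeff_c1 (m : Fin 2 ⊕ Fin 2 →₀ ℕ) (F : Fun (PowerSeries ℂ)) :
    coeff m (c1 F) = PowerSeries.coeff 1 (coeff m F) := by
  classical
  rw [c1, coeff_sum]
  simp only [coeff_monomial]
  rw [Finset.sum_ite_eq' F.support m]
  split_ifs with h
  · rfl
  · rw [notMem_support_iff.1 h, map_zero]

theorem c1_add (F G : Fun (PowerSeries ℂ)) : c1 (F + G) = c1 F + c1 G :=
  MvPolynomial.ext _ _ fun m => by simp only [coeff_add, coeff_c1, map_add]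

theorem c1_sub (F G : Fun (PowerSeries ℂ)) : c1 (F - G) = c1 F - c1 G :=
  MvPolynomial.ext _ _ fun m => by simp only [coeff_sub, coeff_c1, map_sub]

theorem c1_zero : c1 0 = 0 :=
  MvPolynomial.ext _ _ fun m => by simp only [coeff_zero, coeff_c1, map_zero]

theorem c1_mul (F G : Fun (PowerSeries ℂ)) : c1 (F * G) = c0 F * c1 G + c1 F * c0 G :=
  MvPolynomial.ext _ _ fun m => by
    rw [coeff_c1, coeff_mul, map_sum, coeff_add, coeff_mul, coeff_mul, ← Finset.sum_add_distrib]
    refine Finset.sum_congr rfl fun k _ => ?_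
    rw [PowerSeries.coeff_mul, Finset.Nat.antidiagonal_succ]
    simp [coeff_c0, coeff_c1]

theorem c0_C (c : PowerSeries ℂ) : c0 (C c) = C (PowerSeries.constantCoeff c) := by simp [c0]
theorem c0_X (i : Fin 2 ⊕ Fin 2) : c0 (X i) = X i := by simp [c0]

theorem c1_C (c : PowerSeries ℂ) : c1 (C c) = C (PowerSeries.coeff 1 c) := by
  classical
  refine MvPolynomial.ext _ _ fun m => ?_
  rw [coeff_c1, coeff_C, coeff_C]
  split_ifs <;> simp

theorem c1_X (i : Fin 2 ⊕ Fin 2) : c1 (X i) = 0 := by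
  classical
  refine MvPolynomial.ext _ _ fun m => ?_
  rw [coeff_c1, coeff_X, coeff_zero]
  split_ifs <;> simp [PowerSeries.coeff_one]

theorem c1_one : c1 1 = 0 := by
  rw [← C_1, c1_C]; simp [PowerSeries.coeff_one]

theorem c0_pderiv (i : Fin 2 ⊕ Fin 2) (F : Fun (PowerSeries ℂ)) :
    c0 (pderiv i F) = pderiv i (c0 F) := by
  rw [c0, pderiv_map]

/-- The infinitesimal torus action. -/
noncomputable def euler (r : Fin 2 → ℂ) : Derivation ℂ Chart Chart :=
  mkDerivation ℂ (Sum.elim (fun i => C (r i) * X (.inl i)) fun i => -(C (r i) * X (.inr i)))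

theorem coeff_one_unit_inv (v : (PowerSeries ℂ)ˣ) (hv : PowerSeries.constantCoeff v.val = 1) :
    PowerSeries.constantCoeff (v⁻¹).val = 1 ∧
      PowerSeries.coeff 1 (v⁻¹).val = -PowerSeries.coeff 1 v.val := by
  have h0 := congrArg PowerSeries.constantCoeff v.mul_inv
  have h1 := congrArg (PowerSeries.coeff 1) v.mul_inv
  rw [map_mul, hv, one_mul, map_one] at h0
  rw [PowerSeries.coeff_mul, Finset.Nat.antidiagonal_succ] at h1
  simp [PowerSeries.coeff_one, hv, h0] at h1
  exact ⟨h0, eq_neg_of_add_eq_zero_left h1⟩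

/-- Dilation by 1 + rħ + O(ħ²) is an algebra map, so to first order it is the identity plus ħ times
a derivation, determined on the variables. -/
theorem c0_c1_scale {v : Fin 2 → (PowerSeries ℂ)ˣ} {r : Fin 2 → ℂ}
    (h0 : ∀ i, PowerSeries.constantCoeff (v i).val = 1)
    (h1 : ∀ i, PowerSeries.coeff 1 (v i).val = r i) (F : Fun (PowerSeries ℂ)) :
    c0 (scale v F) = c0 F ∧ c1 (scale v F) = c1 F + euler r (c0 F) := by
  induction F using MvPolynomial.induction_on with
  | C c => simp [c0_C]
  | add F G hF hG =>
    simp only [map_add, c1_add, hF, hG]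
    exact ⟨trivial, by ring⟩
  | mul_X F i hF =>
    rcases i with i | i
    · simp only [map_mul, scale_X_inl, c1_mul, c0_C, c0_X, c1_C, c1_X, h0, h1, hF, C_1,
        Derivation.leibniz, euler, mkDerivation_X, Sum.elim_inl, smul_eq_mul]
      exact ⟨by ring, by ring⟩
    · obtain ⟨e0, e1⟩ := coeff_one_unit_inv (v i) (h0 i)
      simp only [map_mul, scale_X_inr, c1_mul, c0_C, c0_X, c1_C, c1_X, h1, hF, e0, e1, C_1,
        Derivation.leibniz, euler, mkDerivation_X, Sum.elim_inr, smul_eq_mul, map_neg]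
      exact ⟨by ring, by ring⟩

theorem qHbar_coeff : PowerSeries.constantCoeff qHbar.val = 1 ∧
    PowerSeries.coeff 1 qHbar.val = 1 / 3 := by
  simp [qHbar, expSeries, PowerSeries.coeff_rescale, PowerSeries.coeff_exp,
    ← PowerSeries.coeff_zero_eq_constantCoeff_apply]

variable (S T : PowerSeries ℂ)

/-- The formal parameters. -/
noncomputable abbrev formal : Params (PowerSeries ℂ) := ⟨qHbar, S, T⟩

/-- The first-order parts of the operators of `z^i`. -/
noncomputable def derZ : Fin 3 → Derivation ℂ Chart Chart :=
  ![(X (.inl 0) : Chart) • euler ![-(1 / 3), -(2 / 3)],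
    (X (.inl 1) : Chart) • euler ![1 / 3, 1 / 3], 0]

/-- The first-order parts of the operators of `w_i`. -/
noncomputable def derW (s : ℂ) : Fin 3 → Derivation ℂ Chart Chart :=
  ![(X (.inr 0) : Chart) • euler ![1 / 3, 2 / 3] + s • pderiv (.inl 0),
    (X (.inr 1) : Chart) • euler ![-(1 / 3), -(1 / 3)] + s • pderiv (.inl 1),
    -(s • ((X (.inl 0) : Chart) • pderiv (.inl 0) + (X (.inl 1) : Chart) • pderiv (.inl 1)))]

theorem c0_c1_twist (F : Fun (PowerSeries ℂ)) :
    (c0 (twA (formal S T) F) = c0 F ∧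
      c1 (twA (formal S T) F) = c1 F + euler ![-(1 / 3), -(2 / 3)] (c0 F)) ∧
    (c0 (twA' (formal S T) F) = c0 F ∧
      c1 (twA' (formal S T) F) = c1 F + euler ![1 / 3, 2 / 3] (c0 F)) ∧
    (c0 (twB (formal S T) F) = c0 F ∧
      c1 (twB (formal S T) F) = c1 F + euler ![1 / 3, 1 / 3] (c0 F)) ∧
    (c0 (twB' (formal S T) F) = c0 F ∧
      c1 (twB' (formal S T) F) = c1 F + euler ![-(1 / 3), -(1 / 3)] (c0 F)) := by
  obtain ⟨q0, q1⟩ := qHbar_coeff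
  obtain ⟨p0, p1⟩ := coeff_one_unit_inv qHbar q0
  have r0 : PowerSeries.constantCoeff (qHbar ^ 2).val = 1 := by
    rw [Units.val_pow_eq_pow_val, map_pow, q0, one_pow]
  have r1 : PowerSeries.coeff 1 (qHbar ^ 2).val = 2 / 3 := by
    rw [Units.val_pow_eq_pow_val, pow_two, PowerSeries.coeff_mul, Finset.Nat.antidiagonal_succ]
    simp [q0, q1]
    norm_num
  obtain ⟨s0, s1⟩ := coeff_one_unit_inv (qHbar ^ 2) r0
  rw [q1] at p1
  rw [r1] at s1
  refine ⟨c0_c1_scale ?_ ?_ F, c0_c1_scale ?_ ?_ F, c0_c1_scale ?_ ?_ F, c0_c1_scale ?_ ?_ F⟩ <;>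
    intro i <;> fin_cases i <;> assumption

theorem const_coeff_ts (hS : PowerSeries.constantCoeff S = 0) (r : ℂ) :
    PowerSeries.constantCoeff ((formal S T).ts r) = PowerSeries.constantCoeff T := by
  simp [Params.ts, hS]

/-- The values of `z^i` on the chart over `ℂ`. -/
noncomputable abbrev arrowFun (t : ℂ) {a b : Node} (x : Arrow a b) : Chart :=
  Arrow.val (chartZ ℂ) (chartW t) x

/-- The first-order part of the operator of an arrow. -/
noncomputable abbrev arrowDer (s : ℂ) {a b : Node} (x : Arrow a b) : Derivation ℂ Chart Chart :=
  Arrow.val derZ (derW s) x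

theorem formal_Q_pow (d : ℕ) : PowerSeries.constantCoeff ((formal S T).Q ^ d) = 1 := by
  rw [map_pow, Params.Q, qHbar_coeff.1, one_pow]

theorem formal_Qi_pow (d : ℕ) : PowerSeries.constantCoeff ((formal S T).Qi ^ d) = 1 := by
  rw [map_pow, Params.Qi, (coeff_one_unit_inv qHbar qHbar_coeff.1).1, one_pow]

variable {S}

/-- The operators of `z^i` to first order in `ħ`. -/
theorem c0_c1_opZ (d : ℕ) (i : Fin 3) :
    ∃ h : Chart, ∀ F, c0 (opZ (formal S T) d i F) = chartZ ℂ i * c0 F ∧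
      c1 (opZ (formal S T) d i F) = chartZ ℂ i * c1 F + derZ i (c0 F) + h * c0 F := by
  fin_cases i
  -- The function h records the first-order part of the prefactor q^d. It depends on the node,
  -- unlike the derivation.
  · refine ⟨C (PowerSeries.coeff 1 ((formal S T).Q ^ d)) * X (.inl 0), fun F => ?_⟩
    obtain ⟨e0, e1⟩ := (c0_c1_twist S T F).1
    simp only [Fin.zero_eta, opZ_zero_apply, ← C_pow, map_mul, c1_mul, c0_C, c0_X, c1_C, c1_X, e0,
      e1, formal_Q_pow, C_1]
    simp [chartZ, derZ]
    ring
  · refine ⟨C (PowerSeries.coeff 1 ((formal S T).Qi ^ d)) * X (.inl 1), fun F => ?_⟩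
    obtain ⟨e0, e1⟩ := (c0_c1_twist S T F).2.2.1
    simp only [Fin.mk_one, opZ_one_apply, ← C_pow, map_mul, c1_mul, c0_C, c0_X, c1_C, c1_X, e0,
      e1, formal_Qi_pow, C_1]
    simp [chartZ, derZ]
    ring
  · exact ⟨0, fun F => by simp [opZ, chartZ, derZ]⟩

/-- The operators of `w_i` to first order in `ħ`. -/
theorem c0_c1_opW (hS : PowerSeries.constantCoeff S = 0) (d : ℕ) (r : ℂ) (i : Fin 3) :
    ∃ h : Chart, ∀ F, c0 (opW (formal S T) d ((formal S T).ts r) i F) =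
        chartW (PowerSeries.constantCoeff T) i * c0 F ∧
      c1 (opW (formal S T) d ((formal S T).ts r) i F) =
        chartW (PowerSeries.constantCoeff T) i * c1 F + derW (PowerSeries.coeff 1 S) i (c0 F)
          + h * c0 F := by
  fin_cases i
  · refine ⟨C (PowerSeries.coeff 1 ((formal S T).Qi ^ d)) * X (.inr 0), fun F => ?_⟩
    obtain ⟨e0, e1⟩ := (c0_c1_twist S T F).2.1
    simp only [Fin.zero_eta, opW_zero_apply, ← C_pow, map_mul, map_add, c1_mul, c1_add, c0_C, c0_X,
      c1_C, c1_X, e0, e1, formal_Qi_pow, C_1, c0_pderiv, hS, C_0]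
    simp [chartW, derW, MvPolynomial.smul_eq_C_mul]
    ring
  · refine ⟨C (PowerSeries.coeff 1 ((formal S T).Q ^ d)) * X (.inr 1), fun F => ?_⟩
    obtain ⟨e0, e1⟩ := (c0_c1_twist S T F).2.2.2
    simp only [Fin.mk_one, opW_one_apply, ← C_pow, map_mul, map_add, c1_mul, c1_add, c0_C, c0_X,
      c1_C, c1_X, e0, e1, formal_Q_pow, C_1, c0_pderiv, hS, C_0]
    simp [chartW, derW, MvPolynomial.smul_eq_C_mul]
    ring
  · refine ⟨C (PowerSeries.coeff 1 ((formal S T).ts r)), fun F => ?_⟩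
    simp only [Fin.reduceFinMk, opW_two_apply, map_mul, map_add, map_sub, c1_mul, c1_add, c1_sub,
      c0_C, c0_X, c1_C, c1_X, c0_pderiv, hS, C_0, const_coeff_ts S T hS]
    simp [chartW, derW, MvPolynomial.smul_eq_C_mul]
    exact ⟨by ring, by ring⟩

theorem c0_c1_op (hS : PowerSeries.constantCoeff S = 0) {a b : Node} (x : Arrow a b) :
    ∃ h : Chart, ∀ F, c0 (op (formal S T) x F) =
        arrowFun (PowerSeries.constantCoeff T) x * c0 F ∧
      c1 (op (formal S T) x F) = arrowFun (PowerSeries.constantCoeff T) x * c1 F +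
        arrowDer (PowerSeries.coeff 1 S) x (c0 F) + h * c0 F := by
  cases x with
  | z01 i => exact c0_c1_opZ T 0 i
  | z12 i => exact c0_c1_opZ T 1 i
  | w10 i => exact c0_c1_opW T hS 1 _ i
  | w21 i => exact c0_c1_opW T hS 2 _ i

/-- The function on the chart given by a path. -/
noncomputable abbrev pathFun (t : ℂ) {a b : Node} (p : Path a b) : Chart :=
  evalPath (chartZ ℂ) (chartW t) p

/-- The first-order part of the operator of a path. -/
noncomputable def pathDer (s t : ℂ) {a : Node} : ∀ {b : Node}, Path a b → Derivation ℂ Chart Chart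
  | _, .nil => 0
  | _, .cons p x => arrowFun t x • pathDer s t p + pathFun t p • arrowDer s x

/-- The operators of paths to first order in `ħ`. -/
theorem c0_c1_opPath (hS : PowerSeries.constantCoeff S = 0) {a b : Node} (p : Path a b) :
    ∃ h : Chart, ∀ F, c0 (opPath (formal S T) p F) =
        pathFun (PowerSeries.constantCoeff T) p * c0 F ∧
      c1 (opPath (formal S T) p F) = pathFun (PowerSeries.constantCoeff T) p * c1 F +
        pathDer (PowerSeries.coeff 1 S) (PowerSeries.constantCoeff T) p (c0 F) + h * c0 F := by
  induction p with
  | nil =>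
    refine ⟨0, fun F => ?_⟩
    rw [pathFun, evalPath_nil, pathDer, opPath]
    simp
  | cons p x ih =>
    obtain ⟨h, hp⟩ := ih
    obtain ⟨k, hx⟩ := c0_c1_op T hS x
    -- This is the multiplication part of the ħ-coefficient of (f_x + ħ(D_x + k))(f_p + ħ(D_p + h)).
    -- The middle term arises when D_x differentiates f_p.
    refine ⟨arrowFun (PowerSeries.constantCoeff T) x * h +
      arrowDer (PowerSeries.coeff 1 S) x (pathFun (PowerSeries.constantCoeff T) p) +
      k * pathFun (PowerSeries.constantCoeff T) p, fun F => ?_⟩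
    rw [opPath, LinearMap.comp_apply, pathFun, evalPath, (hx _).1, (hx _).2, (hp F).1, (hp F).2,
      pathDer, Derivation.add_apply, Derivation.smul_apply, Derivation.smul_apply,
      Derivation.leibniz]
    simp only [smul_eq_mul]
    exact ⟨by ring, by ring⟩

end Semiclassical

/-! ### The Poisson bracket from the first-order derivations -/

section Bracket

open MvPolynomial

theorem wedge_apply (u v : Fin 2 ⊕ Fin 2) (f g : Chart) :
    wedge u v f g = pderiv u f * pderiv v g - pderiv v f * pderiv u g := rfl

theorem poisson_leibniz_right (s : ℂ) (f g h : Chart) :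
    poisson s f (g * h) = g * poisson s f h + h * poisson s f g := by
  simp only [poisson, wedge_apply, Derivation.leibniz, smul_eq_mul]
  ring

theorem poisson_add_right (s : ℂ) (f g h : Chart) :
    poisson s f (g + h) = poisson s f g + poisson s f h := by
  simp only [poisson, wedge_apply, map_add]
  ring

theorem poisson_smul_right (s c : ℂ) (f g : Chart) :
    poisson s f (c • g) = c • poisson s f g := by
  simp only [poisson, wedge_apply, Derivation.map_smul]
  simp only [MvPolynomial.smul_eq_C_mul]
  ring

theorem poisson_antisymm (s : ℂ) (f g : Chart) : poisson s f g = -poisson s g f := by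
  simp only [poisson, wedge_apply]
  ring

theorem poisson_zero_right (s : ℂ) (f : Chart) : poisson s f 0 = 0 := by
  simp [poisson, wedge_apply]

theorem poisson_one_right (s : ℂ) (f : Chart) : poisson s f 1 = 0 := by
  simp [poisson, wedge_apply]

theorem pderiv_y_x (i j : Fin 2) : pderiv (.inr i) (X (.inl j) : Chart) = 0 :=
  pderiv_X_of_ne Sum.inl_ne_inr

theorem pderiv_y0_y1 : pderiv (.inr 0) (X (.inr 1) : Chart) = 0 := pderiv_X_of_ne (by decide)
theorem pderiv_y1_y0 : pderiv (.inr 1) (X (.inr 0) : Chart) = 0 := pderiv_X_of_ne (by decide)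

theorem euler_x (r : Fin 2 → ℂ) (i : Fin 2) :
    euler r (X (.inl i)) = C (r i) * X (.inl i) := by simp [euler]
theorem euler_y (r : Fin 2 → ℂ) (i : Fin 2) :
    euler r (X (.inr i)) = -(C (r i) * X (.inr i)) := by simp [euler]

theorem C_third : (3 * C (1 / 3) : Chart) = 1 ∧ (C (2 / 3) : Chart) = 2 * C (1 / 3) := by
  have h3 : (3 : Chart) = C 3 := by rw [map_ofNat]
  have h2 : (2 : Chart) = C 2 := by rw [map_ofNat]
  rw [h3, h2, ← C_mul, ← C_mul, ← C_1]
  exact ⟨congrArg C (by norm_num), congrArg C (by norm_num)⟩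

/-- For z¹ and z² the twist exponents −2/3 and 1/3 combine to −2/3 − 1/3 = −1, the coefficient of
x¹x² in the bivector. -/
theorem bracket_ZZ (s : ℂ) (i j : Fin 3) :
    derZ i (chartZ ℂ j) - derZ j (chartZ ℂ i) = poisson s (chartZ ℂ i) (chartZ ℂ j) := by
  obtain ⟨h3, h2⟩ := C_third
  fin_cases i <;> fin_cases j <;>
    simp only [Fin.zero_eta, Fin.mk_one, Fin.reduceFinMk, derZ, chartZ, poisson, wedge_apply,
      Matrix.cons_val, Derivation.smul_apply, Derivation.zero_apply, Derivation.map_one_eq_zero,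
      euler_x, pderiv_X_self, pderiv_x0_x1, pderiv_x1_x0, pderiv_y_x, smul_eq_mul, cx, cξ, map_neg,
      Matrix.cons_val_zero, Matrix.cons_val_one] <;>
    grind

theorem bracket_ZW (s t : ℂ) (i j : Fin 3) :
    derZ i (chartW t j) - derW s j (chartZ ℂ i) = poisson s (chartZ ℂ i) (chartW t j) := by
  obtain ⟨h3, h2⟩ := C_third
  fin_cases i <;> fin_cases j <;>
    simp only [Fin.zero_eta, Fin.mk_one, Fin.reduceFinMk, derZ, derW, chartZ, chartW, poisson,
      wedge_apply, Matrix.cons_val, Derivation.smul_apply, Derivation.zero_apply,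
      Derivation.map_one_eq_zero, Derivation.add_apply, Derivation.neg_apply, Derivation.leibniz,
      map_sub, derivation_C, MvPolynomial.smul_eq_C_mul,
      euler_x, euler_y, pderiv_X_self, pderiv_x0_x1, pderiv_x1_x0, pderiv_y0_y1, pderiv_y1_y0,
      pderiv_y_x, pderiv_x_y, smul_eq_mul, cx, cξ, map_neg] <;>
    grind

theorem bracket_WW (s t : ℂ) (i j : Fin 3) :
    derW s i (chartW t j) - derW s j (chartW t i) = poisson s (chartW t i) (chartW t j) := by
  obtain ⟨h3, h2⟩ := C_third
  fin_cases i <;> fin_cases j <;>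
    simp only [Fin.zero_eta, Fin.mk_one, Fin.reduceFinMk, derW, chartW, poisson,
      wedge_apply, Matrix.cons_val, Derivation.smul_apply,
      Derivation.add_apply, Derivation.neg_apply, Derivation.leibniz,
      map_sub, derivation_C, MvPolynomial.smul_eq_C_mul,
      euler_x, euler_y, pderiv_X_self, pderiv_x0_x1, pderiv_x1_x0, pderiv_y0_y1, pderiv_y1_y0,
      pderiv_y_x, pderiv_x_y, smul_eq_mul, cx, cξ, map_neg] <;>
    grind

/-- The left side is the ħ-coefficient of the commutator of f_x + ħD_x and f_y + ħD_y. Equality on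
generators is what matches the deformation with the bivector. -/
theorem bracket_arrow (s t : ℂ) {a b c d : Node} (x : Arrow a b) (y : Arrow c d) :
    arrowDer s x (arrowFun t y) - arrowDer s y (arrowFun t x) =
      poisson s (arrowFun t x) (arrowFun t y) := by
  have hWZ : ∀ i j, derW s i (chartZ ℂ j) - derZ j (chartW t i) =
      poisson s (chartW t i) (chartZ ℂ j) := fun i j => by
    rw [poisson_antisymm, ← bracket_ZW, neg_sub]
  cases x with
  | z01 i =>
    cases y with
    | z01 j => exact bracket_ZZ s i j
    | z12 j => exact bracket_ZZ s i j
    | w10 j => exact bracket_ZW s t i j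
    | w21 j => exact bracket_ZW s t i j
  | z12 i =>
    cases y with
    | z01 j => exact bracket_ZZ s i j
    | z12 j => exact bracket_ZZ s i j
    | w10 j => exact bracket_ZW s t i j
    | w21 j => exact bracket_ZW s t i j
  | w10 i =>
    cases y with
    | z01 j => exact hWZ i j
    | z12 j => exact hWZ i j
    | w10 j => exact bracket_WW s t i j
    | w21 j => exact bracket_WW s t i j
  | w21 i =>
    cases y with
    | z01 j => exact hWZ i j
    | z12 j => exact hWZ i j
    | w10 j => exact bracket_WW s t i j
    | w21 j => exact bracket_WW s t i j

theorem pathFun_nil (t : ℂ) (a : Node) : pathFun t (Path.nil : Path a a) = 1 :=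
  evalPath_nil _ _ a

theorem pathFun_cons (t : ℂ) {a b c : Node} (p : Path a b) (x : b ⟶ c) :
    pathFun t (p.cons x) = arrowFun t x * pathFun t p := by
  rw [pathFun, evalPath]

/-- Both sides satisfy the same Leibniz rule in the path, by the definition of `pathDer`. -/
theorem bracket_arrow_path (s t : ℂ) {a b c d : Node} (x : Arrow a b) (p : Path c d) :
    arrowDer s x (pathFun t p) - pathDer s t p (arrowFun t x) =
      poisson s (arrowFun t x) (pathFun t p) := by
  induction p with
  | nil => rw [pathFun_nil, pathDer, poisson_one_right]; simp
  | cons p y ih =>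
    have h := bracket_arrow s t x (show Arrow _ _ from y)
    rw [pathDer, pathFun_cons, poisson_leibniz_right, ← ih, ← h, Derivation.leibniz,
      Derivation.add_apply, Derivation.smul_apply, Derivation.smul_apply]
    simp only [smul_eq_mul]
    ring

theorem bracket_path (s t : ℂ) {a b c d : Node} (r : Path a b) (p : Path c d) :
    pathDer s t r (pathFun t p) - pathDer s t p (pathFun t r) =
      poisson s (pathFun t r) (pathFun t p) := by
  induction r with
  | nil =>
    rw [pathFun_nil, pathDer, poisson_antisymm, poisson_one_right]; simp
  | cons r y ih =>
    have h := bracket_arrow_path s t (show Arrow _ _ from y) p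
    rw [poisson_antisymm] at ih h
    rw [pathDer, poisson_antisymm, pathFun_cons, poisson_leibniz_right, Derivation.leibniz,
      Derivation.add_apply, Derivation.smul_apply, Derivation.smul_apply, neg_add, ← mul_neg,
      ← mul_neg, ← ih, ← h]
    simp only [smul_eq_mul]
    ring

end Bracket

/-! ### The classical limit and the first-order commutator -/

section Quantization

open MvPolynomial

theorem extend_zero (a b : Node) : extend (0 : Lin ℂ a b) = 0 := Finsupp.mapRange_zero
theorem extend_add {a b : Node} (f g : Lin ℂ a b) : extend (f + g) = extend f + extend g :=
  Finsupp.mapRange_add (map_add _) f g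
theorem extend_single {a b : Node} (p : Path a b) (c : ℂ) :
    extend (Finsupp.single p c) = Finsupp.single p (PowerSeries.C c) := Finsupp.mapRange_single

theorem hcoeff_zero (n : ℕ) (a b : Node) : hcoeff n (0 : Lin (PowerSeries ℂ) a b) = 0 :=
  Finsupp.mapRange_zero
theorem hcoeff_add (n : ℕ) {a b : Node} (f g : Lin (PowerSeries ℂ) a b) :
    hcoeff n (f + g) = hcoeff n f + hcoeff n g := Finsupp.mapRange_add (map_add _) f g
theorem hcoeff_sub (n : ℕ) {a b : Node} (f g : Lin (PowerSeries ℂ) a b) :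
    hcoeff n (f - g) = hcoeff n f - hcoeff n g := Finsupp.mapRange_sub (map_sub _) f g
theorem hcoeff_single (n : ℕ) {a b : Node} (p : Path a b) (c : PowerSeries ℂ) :
    hcoeff n (Finsupp.single p c) = Finsupp.single p (PowerSeries.coeff n c) :=
  Finsupp.mapRange_single

theorem hcoeff_zero_extend {a b : Node} (f : Lin ℂ a b) : hcoeff 0 (extend f) = f :=
  Finsupp.ext fun p => by simp [hcoeff, extend]

variable {S : PowerSeries ℂ} (T : PowerSeries ℂ)

/-- The function on the chart given by a combination of paths. -/
noncomputable abbrev linFun (t : ℂ) (a b : Node) : Lin ℂ a b →ₗ[ℂ] Chart :=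
  evalLin (chartZ ℂ) (chartW t) a b

/-- The first-order part of the operator of a combination of paths. -/
noncomputable def linDer (s t : ℂ) (a b : Node) : Lin ℂ a b →ₗ[ℂ] Derivation ℂ Chart Chart :=
  Finsupp.linearCombination ℂ fun p => pathDer s t p

theorem linDer_single (s t : ℂ) {a b : Node} (p : Path a b) (c : ℂ) :
    linDer s t a b (Finsupp.single p c) = c • pathDer s t p := by simp [linDer]

theorem bracket_lin (s t : ℂ) {a b c d : Node} (f : Lin ℂ a b) (g : Lin ℂ c d) :
    linDer s t a b f (linFun t c d g) - linDer s t c d g (linFun t a b f) =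
      poisson s (linFun t a b f) (linFun t c d g) := by
  induction g using Finsupp.induction_linear with
  | zero => simp [poisson_zero_right]
  | add g g' h h' =>
    rw [map_add, map_add, map_add, poisson_add_right, ← h, ← h', Derivation.add_apply]
    ring
  | single p y =>
    induction f using Finsupp.induction_linear with
    | zero => rw [poisson_antisymm, map_zero (linFun t a b), poisson_zero_right]; simp
    | add f f' h h' =>
      rw [poisson_antisymm] at h h' ⊢
      rw [map_add, map_add, map_add, poisson_add_right, neg_add, ← h, ← h', Derivation.add_apply]
      ring
    | single r x =>
      rw [linFun, linFun, evalLin_single, evalLin_single, linDer_single, linDer_single,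
        poisson_smul_right, poisson_antisymm, poisson_smul_right, ← smul_neg, ← poisson_antisymm,
        ← bracket_path, Derivation.smul_apply, Derivation.smul_apply, Derivation.map_smul, Derivation.map_smul,
        smul_sub, smul_sub, smul_comm y x (pathDer s t r (pathFun t p))]

theorem c0_opLin (hS : PowerSeries.constantCoeff S = 0) {a b : Node}
    (f : Lin (PowerSeries ℂ) a b) (F : Fun (PowerSeries ℂ)) :
    c0 (opLin (formal S T) a b f F) =
      linFun (PowerSeries.constantCoeff T) a b (hcoeff 0 f) * c0 F := by
  induction f using Finsupp.induction_linear with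
  | zero => simp [hcoeff_zero]
  | add f g hf hg => rw [map_add, LinearMap.add_apply, map_add, hf, hg, hcoeff_add, map_add, add_mul]
  | single p c =>
    obtain ⟨h, hp⟩ := c0_c1_opPath T hS p
    rw [opLin_single, LinearMap.smul_apply, MvPolynomial.smul_eq_C_mul, map_mul, c0_C, (hp F).1,
      hcoeff_single, linFun, evalLin_single, MvPolynomial.smul_eq_C_mul, mul_assoc,
      PowerSeries.coeff_zero_eq_constantCoeff_apply]

theorem c1_opLin_extend (hS : PowerSeries.constantCoeff S = 0) {a b : Node} (f : Lin ℂ a b) :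
    ∃ h : Chart, ∀ F, c1 (opLin (formal S T) a b (extend f) F) =
      linFun (PowerSeries.constantCoeff T) a b f * c1 F +
        linDer (PowerSeries.coeff 1 S) (PowerSeries.constantCoeff T) a b f (c0 F) + h * c0 F := by
  induction f using Finsupp.induction_linear with
  | zero => exact ⟨0, fun F => by simp [extend_zero, c1_zero]⟩
  | add f g hf hg =>
    obtain ⟨h, hf⟩ := hf
    obtain ⟨k, hg⟩ := hg
    refine ⟨h + k, fun F => ?_⟩
    rw [extend_add, map_add, LinearMap.add_apply, c1_add, hf, hg, map_add, map_add,
      Derivation.add_apply]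
    ring
  | single p c =>
    obtain ⟨h, hp⟩ := c0_c1_opPath T hS p
    refine ⟨c • h, fun F => ?_⟩
    rw [extend_single, opLin_single, LinearMap.smul_apply, MvPolynomial.smul_eq_C_mul, c1_mul,
      c0_C, c1_C, (hp F).2, linFun, evalLin_single, linDer_single, Derivation.smul_apply]
    simp only [MvPolynomial.smul_eq_C_mul, PowerSeries.constantCoeff_C, PowerSeries.coeff_C,
      one_ne_zero, if_false, C_0]
    ring

/-- For f divisible by ħ, the first-order corrections of the operators enter only at order ħ², so
the classical symbol of the ħ-coefficient remains. -/
theorem c1_symb_of_hcoeff_zero (hS : PowerSeries.constantCoeff S = 0) {a b : Node}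
    {f : Lin (PowerSeries ℂ) a b} (hf : hcoeff 0 f = 0) :
    c1 (symb (formal S T) a b f) =
      linFun (PowerSeries.constantCoeff T) a b (hcoeff 1 f) := by
  have key : c1 (symb (formal S T) a b f) =
      linFun (PowerSeries.constantCoeff T) a b (hcoeff 1 f) +
        Finsupp.linearCombination ℂ (fun p => c1 (opPath (formal S T) p 1)) (hcoeff 0 f) := by
    clear hf
    induction f using Finsupp.induction_linear with
    | zero => simp [hcoeff_zero, c1_zero]
    | add f g hf hg =>
      rw [map_add, c1_add, hf, hg, hcoeff_add, hcoeff_add, map_add, map_add]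
      ring
    | single p c =>
      obtain ⟨h, hp⟩ := c0_c1_opPath T hS p
      rw [symb_apply, opLin_single, LinearMap.smul_apply, MvPolynomial.smul_eq_C_mul, c1_mul, c0_C,
        c1_C, (hp 1).1, c0.map_one, mul_one, hcoeff_single, hcoeff_single, linFun, evalLin_single,
        Finsupp.linearCombination_single, MvPolynomial.smul_eq_C_mul, MvPolynomial.smul_eq_C_mul,
        PowerSeries.coeff_zero_eq_constantCoeff_apply, add_comm]
  rw [key, hf, map_zero, add_zero]

/-- Reduction does not change the symbol, so no star product has to be computed explicitly:
composition of operators suffices. -/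
theorem symb_star {a b c : Node} (P : Params (PowerSeries ℂ)) (u : Lin (PowerSeries ℂ) b c)
    (v : Lin (PowerSeries ℂ) a b) :
    symb P a c (star P u v) = opLin P b c u (opLin P a b v 1) := by
  have h := symb_eq_zero_of_mem P (concat_sub_star_mem P u v)
  rw [map_sub, sub_eq_zero] at h
  rw [← h, symb_apply, opLin_concat, LinearMap.comp_apply]

theorem eq_of_symb_eq {K : Type*} [CommRing K] [Algebra ℂ K] (P : Params K) {a b : Node}
    {f g : Lin K a b} (hf : f ∈ irr P a b) (hg : g ∈ irr P a b) (h : symb P a b f = symb P a b g) :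
    f = g :=
  sub_eq_zero.1 (eq_zero_of_symb_eq_zero P (sub_mem hf hg) (by rw [map_sub, h, sub_self]))

theorem hcoeff_mem_irr {P : Params (PowerSeries ℂ)} (P₀ : Params ℂ) (n : ℕ) {a b : Node}
    {f : Lin (PowerSeries ℂ) a b} (hf : f ∈ irr P a b) : hcoeff n f ∈ irr P₀ a b := fun _ hp =>
  rightStep_eq_none_of_params P₀ (hf (Finsupp.support_mapRange hp))

theorem linFun_star (t : ℂ) {a b c : Node} (u : Lin ℂ b c) (v : Lin ℂ a b) :
    linFun t a c (star (classical t) u v) = linFun t b c u * linFun t a b v := by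
  have h := symb_eq_zero_of_mem (classical t) (concat_sub_star_mem (classical t) u v)
  rw [map_sub, sub_eq_zero, symb_classical, symb_classical, evalLin_concat] at h
  exact h.symm

/-- The star product deforms the product of the quiver algebra. -/
theorem hcoeff_zero_star (hS : PowerSeries.constantCoeff S = 0) {a b c : Node} (u : Lin ℂ b c)
    (v : Lin ℂ a b) :
    hcoeff 0 (star (formal S T) (extend u) (extend v)) =
      star (classical (PowerSeries.constantCoeff T)) u v := by
  refine eq_of_symb_eq _ (hcoeff_mem_irr _ 0 (star_mem_irr (formal S T) _ _))
    (star_mem_irr _ _ _) ?_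
  have h := congrArg c0 (symb_star (formal S T) (extend u) (extend v))
  rw [symb_apply, c0_opLin T hS, c0_opLin T hS, c0_opLin T hS, hcoeff_zero_extend,
    hcoeff_zero_extend, c0.map_one, mul_one, mul_one] at h
  rw [symb_classical, symb_classical]
  exact h.trans (linFun_star _ u v).symm

/-- The star product quantises the Poisson bracket. -/
theorem linFun_hcoeff_one_commutator (hS : PowerSeries.constantCoeff S = 0) {a : Node}
    (f g : Lin ℂ a a) :
    linFun (PowerSeries.constantCoeff T) a a
        (hcoeff 1 (star (formal S T) (extend f) (extend g)
          - star (formal S T) (extend g) (extend f))) =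
      poisson (PowerSeries.coeff 1 S) (linFun (PowerSeries.constantCoeff T) a a f)
        (linFun (PowerSeries.constantCoeff T) a a g) := by
  -- The classical product is commutative at one node, so the commutator is divisible by ħ and
  -- `c1_symb_of_hcoeff_zero` applies.
  have hcomm : star (classical (PowerSeries.constantCoeff T)) f g =
      star (classical (PowerSeries.constantCoeff T)) g f := by
    refine eq_of_symb_eq _ (star_mem_irr _ _ _) (star_mem_irr _ _ _) ?_
    rw [symb_classical, symb_classical]
    exact (linFun_star _ f g).trans ((mul_comm _ _).trans (linFun_star _ g f).symm)
  rw [← c1_symb_of_hcoeff_zero T hS (by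
    rw [hcoeff_sub, hcoeff_zero_star T hS, hcoeff_zero_star T hS, hcomm, sub_self]),
    map_sub, symb_star, symb_star, c1_sub, ← bracket_lin]
  obtain ⟨h, hf⟩ := c1_opLin_extend T hS f
  obtain ⟨k, hg⟩ := c1_opLin_extend T hS g
  -- At the constant function 1 the derivations vanish, so the two orders give f k + D_f g + h g and
  -- g h + D_g f + k f. In the difference h and k cancel.
  simp only [hf, hg, c0_opLin T hS, hcoeff_zero_extend, c0.map_one, c1_one,
    mul_one, Derivation.map_one_eq_zero]
  ring

end Quantization

end TP2

theorem mainTheorem1 :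
    -- The reduction system, the deformed algebra and the star product, for all `q, s, t`.
    (∀ (K : Type*) [CommRing K] [Algebra ℂ K] (P : TP2.Params K),
      -- right reduction terminates, and it does not change classes modulo the essential rules
      (∀ (a b : TP2.Node) (f : TP2.Lin K a b),
        (∃ n : ℕ, (TP2.redStep P a b)^[n] f ∈ TP2.irr P a b) ∧
        f - TP2.redR P f ∈ TP2.relIdeal (TP2.essRel P) a b) ∧
      -- the superfluous rules are consequences of the essential ones
      (∀ a b : TP2.Node,
        TP2.supRel P a b ⊆ (TP2.relIdeal (TP2.essRel P) a b : Set (TP2.Lin K a b))) ∧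
      -- the irreducible paths form a basis of the algebra defined by the essential rules
      (∀ a b : TP2.Node, IsCompl (TP2.irr P a b) (TP2.relIdeal (TP2.essRel P) a b)) ∧
      -- the star product on irreducible paths is closed, unital and associative
      (∀ (a b c : TP2.Node), ∀ u ∈ TP2.irr P b c, ∀ v ∈ TP2.irr P a b,
        TP2.star P u v ∈ TP2.irr P a c) ∧
      (∀ (a b : TP2.Node), ∀ u ∈ TP2.irr P a b,
        TP2.star P u (TP2.mon 1 (TP2.idp a)) = u ∧ TP2.star P (TP2.mon 1 (TP2.idp b)) u = u) ∧
      (∀ (a b c d : TP2.Node), ∀ u ∈ TP2.irr P c d, ∀ v ∈ TP2.irr P b c, ∀ w ∈ TP2.irr P a b,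
        TP2.star P (TP2.star P u v) w = TP2.star P u (TP2.star P v w))) ∧
    -- For `q = 1`, `s = 0` one gets the quiver algebra of `O ⊕ O(1) ⊕ O(2)` on `T*ℙ²`, with
    -- `∑ w_i z^i = 0` replaced by `∑ w_i z^i = t`.
    (∀ (K : Type*) [CommRing K] [Algebra ℂ K] (t : K) (a b : TP2.Node),
      TP2.relIdeal (TP2.essRel (⟨1, 0, t⟩ : TP2.Params K)) a b
        = TP2.relIdeal (TP2.quiverRel t) a b ∧
      LinearMap.ker (TP2.evalLin (K := K) (TP2.coordZ t) (TP2.coordW t) a b)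
        = TP2.relIdeal (TP2.quiverRel t) a b ∧
      LinearMap.range (TP2.evalLin (K := K) (TP2.coordZ t) (TP2.coordW t) a b)
        = TP2.weightPart t (b.pos - a.pos)) ∧
    -- For `q = exp (ħ / 3)`, `s = s₁ ħ + …`, `t = t₀ + t₁ ħ + …` the star product deforms the
    -- product of the quiver algebra of `∑ w_i z^i = t₀` and quantises the Poisson bracket.
    (∀ S T : PowerSeries ℂ, PowerSeries.constantCoeff S = 0 →
      ∀ (P : TP2.Params (PowerSeries ℂ)) (P₀ : TP2.Params ℂ), P = ⟨TP2.qHbar, S, T⟩ →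
      P₀ = ⟨1, 0, PowerSeries.constantCoeff T⟩ →
      (∀ (a b c : TP2.Node), ∀ u ∈ TP2.irr P₀ b c, ∀ v ∈ TP2.irr P₀ a b,
        TP2.hcoeff 0 (TP2.star P (TP2.extend u) (TP2.extend v)) = TP2.star P₀ u v) ∧
      (∀ f ∈ TP2.irr P₀ TP2.Node.e0 TP2.Node.e0, TP2.chart P₀.t f = 0 → f = 0) ∧
      (∀ f ∈ TP2.irr P₀ TP2.Node.e0 TP2.Node.e0, ∀ g ∈ TP2.irr P₀ TP2.Node.e0 TP2.Node.e0,
        TP2.chart P₀.t (TP2.star P₀ f g) = TP2.chart P₀.t f * TP2.chart P₀.t g ∧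
        TP2.chart P₀.t (TP2.hcoeff 1 (TP2.star P (TP2.extend f) (TP2.extend g)
            - TP2.star P (TP2.extend g) (TP2.extend f)))
          = TP2.poisson (PowerSeries.coeff 1 S) (TP2.chart P₀.t f) (TP2.chart P₀.t g))) := by
  refine ⟨fun K _ _ P => ⟨fun a b f => ⟨TP2.redStep_terminates P f, TP2.sub_redR_mem P f⟩,
    TP2.supRel_subset_essIdeal P, TP2.isCompl_irr_essIdeal P,
    fun a b c u _ v _ => TP2.star_mem_irr P u v,
    fun a b u hu => ⟨TP2.star_idp P hu, TP2.idp_star P hu⟩,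
    fun a b c d u _ v _ w _ => TP2.star_assoc P u v w⟩,
    fun K _ _ t a b => ⟨TP2.essIdeal_classical t a b, TP2.ker_evalLin_coord t a b,
      TP2.range_evalLin_coord t a b⟩, ?_⟩
  rintro S T hS P P₀ rfl rfl
  -- `chart` and `linFun` evaluate at the same coordinate functions and agree by definition.
  refine ⟨fun a b c u _ v _ => TP2.hcoeff_zero_star T hS u v, fun f hf h => ?_,
    fun f _ g _ => ⟨TP2.linFun_star _ f g, TP2.linFun_hcoeff_one_commutator T hS f g⟩⟩
  exact TP2.eq_zero_of_symb_eq_zero _ hf ((TP2.symb_classical _ f).trans h)
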